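/- Let $X=(X_t)_{t\ge 0}$ be a real-valued Lévy process on a probability space $(\Omega,\mathscr F,\mathbb P)$ with Lévy triplet $(b,\sigma^2,\nu)$ (with respect to the truncation function $z\mathbf 1_{\{|z|\le 1\}}$), that is, $$\mathbb E\big(e^{iuX_t}\big)=\exp\bigg(t\Big(ibu-\frac{\sigma^2u^2}{2}+\int_{\mathbb R\setminus\{0\}}\big(e^{iuz}-1-iuz\mathbf 1_{\{|z|\le 1\}}\big)\,\nu(dz)\Big)\bigg),\qquad t\ge 0,\ u\in\mathbb R,$$ where $\nu$ is a Lévy measure, i.e. $\nu(\{0\})=0$ and $\int \min(1,z^2)\,\nu(dz)<\infty$. Assume that $(e^{X_t})_{t\ge0}$ is a martingale in the sense that $$\int_{(1,\infty)}e^z\,\nu(dz)<\infty\quad\text{and}\quad b=-\frac{\sigma^2}{2}-\int_{\mathbb R\setminus\{0\}}\big(e^z-1-z\mathbf 1_{\{|z|\le1\}}\big)\,\nu(dz).$$ Let $r\ge 0$ (interest rate), $\delta\ge 0$ (dividend yield), $K>0$ (strike) and $T>0$ (maturity). For $t\in[0,T]$ and $s\ge 0$ let $$P_e(t,s)=\mathbb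 E\Big(e^{-r(T-t)}\big(K-s\,e^{(r-\delta)(T-t)+X_{T-t}}\big)^+\Big)$$ be the European put price, let $$b_e(t)=\inf\big\{s\ge 0:\ P_e(t,s)>(K-s)^+\big\}$$ be the European critical price, and set $\zeta(\tau)=K/b_e(T-\tau)-1$ for $\tau\in(0,T]$. Let $$d=r-\delta-\int_{(0,\infty)}(e^z-1)\,\nu(dz)\in[-\infty,\infty).$$ If $\sigma>0$ and $d>0$, then $$\lim_{\tau\to0^+}\frac{\zeta(\tau)}{\sqrt{-\tau\ln\tau}}=\sigma.$$ -/

import Mathlib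

open MeasureTheory ProbabilityTheory Filter Topology Set
open scoped NNReal ENNReal

noncomputable section

namespace ExpLevy

/-- `ν` is a Lévy measure on `ℝ`: no mass at the origin and `∫ min(1, z²) ν(dz) < ∞`. -/
structure IsLevyMeasure (ν : Measure ℝ) : Prop where
  zero : ν {0} = 0
  lintegral_lt_top : ∫⁻ z, ENNReal.ofReal (min 1 (z ^ 2)) ∂ν < ∞

/-- The Lévy–Khintchine exponent of the triplet `(b, σ², ν)`, with truncation function
`z ↦ z 1_{|z| ≤ 1}`:
`ψ(u) = i b u - σ² u² / 2 + ∫ (e^{iuz} - 1 - i u z 1_{|z| ≤ 1}) ν(dz)`. -/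
def levyExponent (b sigmaSq : ℝ) (ν : Measure ℝ) (u : ℝ) : ℂ :=
  Complex.I * b * u - sigmaSq * u ^ 2 / 2
    + ∫ z : ℝ, (Complex.exp (Complex.I * u * z) - 1
        - Complex.I * u * ((if |z| ≤ 1 then z else 0 : ℝ) : ℂ)) ∂ν

/-- `X` is a real-valued Lévy process on `[0, ∞)` under `P`. -/
structure IsLevyProcess {Ω : Type*} [MeasurableSpace Ω] (X : ℝ≥0 → Ω → ℝ) (P : Measure Ω) :
    Prop where
  measurable : ∀ t, Measurable (X t)
  start : ∀ᵐ ω ∂P, X 0 ω = 0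
  indep : HasIndepIncrements X P
  stationary : ∀ s t : ℝ≥0, IdentDistrib (fun ω => X (s + t) ω - X s ω) (X t) P P
  stochContinuous : ∀ t : ℝ≥0, TendstoInMeasure P X (𝓝 t) (X t)
  cadlag : ∀ᵐ ω ∂P, ∀ t : ℝ≥0, ContinuousWithinAt (fun s => X s ω) (Ici t) t ∧
    ∃ l : ℝ, Tendsto (fun s => X s ω) (𝓝[<] t) (𝓝 l)

/-- `X` is a Lévy process with Lévy triplet `(b, σ², ν)`: `ν` is a Lévy measure and
`E e^{iuX_t} = e^{t ψ(u)}` for all `t ≥ 0` and `u ∈ ℝ`. -/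
structure IsLevyProcessWithTriplet {Ω : Type*} [MeasurableSpace Ω] (X : ℝ≥0 → Ω → ℝ)
    (P : Measure Ω) (b sigmaSq : ℝ) (ν : Measure ℝ) : Prop where
  isLevyProcess : IsLevyProcess X P
  isLevyMeasure : IsLevyMeasure ν
  charFun_eq : ∀ (t : ℝ≥0) (u : ℝ),
    charFun (P.map (X t)) u = Complex.exp ((t : ℝ) * levyExponent b sigmaSq ν u)

/-- The conditions on the triplet under which `(e^{X_t})` is a martingale:
`∫_{z > 1} e^z ν(dz) < ∞` and `b = -σ²/2 - ∫ (e^z - 1 - z 1_{|z| ≤ 1}) ν(dz)`. -/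
structure MartingaleCondition (b sigmaSq : ℝ) (ν : Measure ℝ) : Prop where
  exp_moment : ∫⁻ z in Ioi (1 : ℝ), ENNReal.ofReal (Real.exp z) ∂ν < ∞
  drift : b = -sigmaSq / 2 - ∫ z : ℝ, (Real.exp z - 1 - (if |z| ≤ 1 then z else 0)) ∂ν

/-- `d = r - δ - ∫_{(0,∞)} (e^z - 1) ν(dz)`, an extended real number: it is `-∞` if the
integral diverges. -/
def dConst (r δ : ℝ) (ν : Measure ℝ) : EReal :=
  ((r - δ : ℝ) : EReal)
    - ((∫⁻ z in Ioi (0 : ℝ), ENNReal.ofReal (Real.exp z - 1) ∂ν : ℝ≥0∞) : EReal)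

/-- The European put price
`P_e(t, s) = E[e^{-r(T-t)} (K - s e^{(r-δ)(T-t) + X_{T-t}})⁺]`, for `t ≤ T` and `s ≥ 0`. -/
def euroPut {Ω : Type*} [MeasurableSpace Ω] (X : ℝ≥0 → Ω → ℝ) (P : Measure Ω)
    (r δ K T t s : ℝ) : ℝ :=
  ∫ ω, Real.exp (-r * (T - t)) *
    max (K - s * Real.exp ((r - δ) * (T - t) + X (T - t).toNNReal ω)) 0 ∂P

/-- The European critical price `b_e(t) = inf {s ≥ 0 : P_e(t, s) > (K - s)⁺}`. -/
def euroCritPrice {Ω : Type*} [MeasurableSpace Ω] (X : ℝ≥0 → Ω → ℝ) (P : Measure Ω)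
    (r δ K T t : ℝ) : ℝ :=
  sInf {s : ℝ | 0 ≤ s ∧ max (K - s) 0 < euroPut X P r δ K T t s}

/-- `ζ(τ) = K / b_e(T - τ) - 1`. -/
def zeta {Ω : Type*} [MeasurableSpace Ω] (X : ℝ≥0 → Ω → ℝ) (P : Measure Ω)
    (r δ K T τ : ℝ) : ℝ :=
  K / euroCritPrice X P r δ K T (T - τ) - 1

end ExpLevy

end

/-! Write y = √(-τ ln τ). The put at s = K e^{-ay} is compared with K - s: for small τ it is worth
at most K - s if a > σ, and strictly more if 0 < a < σ. Convexity in s (`euroPut_le_of_le`) then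
traps the critical price between such values of s, and e^{ay} - 1 ~ ay.

By put-call parity the question is whether an out-of-the-money call beats carry terms of order τ.
Since y²/τ = -ln τ, a Gaussian of variance σ²τ has density about τ^{a²/(2σ²) - 1/2} at distance ay,
so up to logarithms the call is of order τ^{a²/(2σ²) + 1/2}. This crosses τ exactly at a = σ.

Jumps do not move the threshold. From below, they multiply the Gaussian price by independent factors
of mean one, which can only raise a put (`gaussian_put_le`, `gaussian_put_ge`). From above
(`put_le_of_exponent_bound`), discarding the upward jumps but keeping their compensator leaves the
net carry dτ > 0. The downward jumps add at most ηθ² + Mθ to the exponent, with η arbitrarily small,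
and a Chernoff bound for the call finishes (`eventually_chernoff_le`).

No path decomposition is needed: the law of X_τ is the weak limit of explicit laws without small
jumps (`tendsto_integral_putPayoff`), and both bounds are uniform in the cutoff. -/

noncomputable section

namespace ExpLevy

/-! ### Exponential moments and compound Poisson laws -/

/-- The exponential moment `∫ e^{zx} μ(dx)` converges absolutely and equals `w`. -/
structure HasExpMoment (μ : Measure ℝ) (z w : ℂ) : Prop where
  integrable : Integrable (fun x : ℝ => Complex.exp (z * x)) μ
  integral_eq : ∫ x : ℝ, Complex.exp (z * x) ∂μ = w

/-- The argument z is complex so that the same computation yields characteristic functions (z = iu)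
and real exponential moments (z = θ). -/
lemma HasExpMoment.conv {μ ρ : Measure ℝ} [SFinite μ] [SFinite ρ] {z w w' : ℂ}
    (h : HasExpMoment μ z w) (h' : HasExpMoment ρ z w') : HasExpMoment (μ ∗ ρ) z (w * w') := by
  have hmul : ∀ x y : ℝ, Complex.exp (z * ((x + y : ℝ) : ℂ))
      = Complex.exp (z * x) * Complex.exp (z * y) := fun x y => by
    rw [← Complex.exp_add]; push_cast; ring_nf
  have hint : Integrable (fun x : ℝ => Complex.exp (z * x)) (μ ∗ ρ) := by
    unfold Measure.conv
    rw [integrable_map_measure (by fun_prop) (by fun_prop)]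
    refine (h.integrable.mul_prod h'.integrable).congr (ae_of_all _ fun p => ?_)
    simp [hmul, -Complex.ofReal_add]
  refine ⟨hint, ?_⟩
  rw [integral_conv hint]
  simp_rw [hmul, integral_const_mul, integral_mul_const, h.integral_eq, h'.integral_eq]

lemma hasExpMoment_dirac (a : ℝ) (z : ℂ) :
    HasExpMoment (Measure.dirac a) z (Complex.exp (z * a)) :=
  ⟨integrable_dirac (by simp), by simp⟩

lemma hasExpMoment_gaussianReal (m : ℝ) (v : ℝ≥0) (z : ℂ) :
    HasExpMoment (gaussianReal m v) z (Complex.exp (z * m + v * z ^ 2 / 2)) := by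
  refine ⟨?_, complexMGF_id_gaussianReal z⟩
  refine (integrable_norm_iff (by fun_prop)).1 ?_
  simpa [Complex.norm_exp] using integrable_exp_mul_gaussianReal (μ := m) (v := v) z.re

/-- The iterated convolution powers of a measure. -/
def convPow (ν : Measure ℝ) : ℕ → Measure ℝ
  | 0 => Measure.dirac 0
  | k + 1 => ν ∗ convPow ν k

instance isFiniteMeasure_convPow (ν : Measure ℝ) [IsFiniteMeasure ν] (k : ℕ) :
    IsFiniteMeasure (convPow ν k) := by
  induction k with
  | zero => unfold convPow; infer_instance
  | succ k ih => unfold convPow; infer_instance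

lemma HasExpMoment.iterate_conv {ν : Measure ℝ} [IsFiniteMeasure ν] {z w : ℂ}
    (h : HasExpMoment ν z w) (k : ℕ) : HasExpMoment (convPow ν k) z (w ^ k) := by
  induction k with
  | zero => simpa [convPow] using hasExpMoment_dirac 0 z
  | succ k ih => rw [pow_succ']; exact h.conv ih

/-- The compound Poisson law with finite jump intensity measure `ν`, i.e.
`e^{-ν(ℝ)} ∑ₖ ν^{∗k} / k!`. -/
def compoundPoisson (ν : Measure ℝ) : Measure ℝ :=
  Measure.sum fun k : ℕ =>
    ENNReal.ofReal (Real.exp (-ν.real univ) / (k.factorial : ℝ)) • convPow ν k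

lemma HasExpMoment.exp_sub_mass {ν : Measure ℝ} [IsFiniteMeasure ν] {z w : ℂ}
    (h : HasExpMoment ν z w) :
    HasExpMoment (compoundPoisson ν) z (Complex.exp (w - (ν.real univ : ℝ))) := by
  -- The modulus of e^{zx} is e^{Re(z) x}, so absolute summability over the convolution powers
  -- reduces to the real exponential series of R.
  have hre : HasExpMoment ν (z.re : ℂ) ((∫ x : ℝ, Real.exp (z.re * x) ∂ν : ℝ) : ℂ) := by
    refine ⟨(integrable_norm_iff (by fun_prop)).1 ?_, ?_⟩
    · simpa [Complex.norm_exp] using h.integrable.norm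
    · rw [← integral_complex_ofReal]; simp
  set R := ∫ x : ℝ, Real.exp (z.re * x) ∂ν
  have hnorm : ∀ k, ∫ x : ℝ, ‖Complex.exp (z * x)‖ ∂(convPow ν k) = R ^ k := fun k => by
    have := (hre.iterate_conv k).integral_eq
    have h2 : ∀ x : ℝ, Complex.exp (z.re * x) = ((Real.exp (z.re * x) : ℝ) : ℂ) := by simp
    simp_rw [h2, integral_complex_ofReal] at this
    simp only [Complex.norm_exp, Complex.mul_re, Complex.ofReal_re, Complex.ofReal_im, mul_zero,
      sub_zero]
    exact_mod_cast this
  have hint : Integrable (fun x : ℝ => Complex.exp (z * x)) (compoundPoisson ν) := by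
    refine integrable_sum_measure (fun k => (h.iterate_conv k).integrable.smul_measure (by simp)) ?_
    have hc : ∀ k : ℕ, (ENNReal.ofReal (Real.exp (-ν.real univ) / (k.factorial : ℝ))).toReal
        = Real.exp (-ν.real univ) / (k.factorial : ℝ) := fun k =>
      ENNReal.toReal_ofReal (by positivity)
    simp_rw [integral_smul_measure, hnorm, hc, smul_eq_mul]
    refine ((Real.summable_pow_div_factorial R).mul_left (Real.exp (-ν.real univ))).congr
      fun k => ?_
    ring
  refine ⟨hint, ?_⟩
  have hs := hasSum_integral_measure hint
  refine hs.unique ?_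
  have hE : HasSum (fun k : ℕ => Complex.exp (-(ν.real univ : ℝ)) * (w ^ k / k.factorial))
      (Complex.exp (-(ν.real univ : ℝ)) * Complex.exp w) := by
    rw [Complex.exp_eq_exp_ℂ]
    exact (NormedSpace.expSeries_div_hasSum_exp w).mul_left _
  rw [← Complex.exp_add, neg_add_eq_sub] at hE
  refine Eq.subst (motive := fun f => HasSum f _) (funext fun k => ?_) hE
  rw [integral_smul_measure, (h.iterate_conv k).integral_eq, ENNReal.toReal_ofReal (by positivity)]
  simp only [Complex.real_smul]
  push_cast
  ring

instance isProbabilityMeasure_compoundPoisson (ν : Measure ℝ) [IsFiniteMeasure ν] :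
    IsProbabilityMeasure (compoundPoisson ν) := by
  have h0 : HasExpMoment ν 0 (ν.real univ : ℝ) := ⟨by simp, by simp⟩
  have h := h0.exp_sub_mass
  have h1 := h.integrable
  simp only [zero_mul, Complex.exp_zero] at h1
  have : IsFiniteMeasure (compoundPoisson ν) := by
    rwa [integrable_const_iff_isFiniteMeasure one_ne_zero] at h1
  have h2 := h.integral_eq
  simp only [zero_mul, Complex.exp_zero, integral_const, Complex.real_smul, mul_one, sub_self] at h2
  refine ⟨?_⟩
  have h3 : (compoundPoisson ν).real univ = 1 := by exact_mod_cast h2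
  rwa [measureReal_def, ENNReal.toReal_eq_one_iff] at h3

lemma hasExpMoment_compoundPoisson {ν : Measure ℝ} [IsFiniteMeasure ν] {z : ℂ}
    (h : Integrable (fun x : ℝ => Complex.exp (z * x)) ν) :
    HasExpMoment (compoundPoisson ν) z
      (Complex.exp (∫ x : ℝ, (Complex.exp (z * x) - 1) ∂ν)) := by
  have := (HasExpMoment.mk h rfl).exp_sub_mass
  rw [integral_sub h (by simp)]
  simpa using this

lemma ae_nonneg_conv {μ ρ : Measure ℝ} [SFinite μ] [SFinite ρ] (h : ∀ᵐ x ∂μ, 0 ≤ x)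
    (h' : ∀ᵐ x ∂ρ, 0 ≤ x) : ∀ᵐ x ∂(μ ∗ ρ), 0 ≤ x := by
  unfold Measure.conv
  rw [ae_map_iff (by fun_prop) (measurableSet_Ici (a := (0 : ℝ)))]
  filter_upwards [Measure.quasiMeasurePreserving_fst.ae h,
    Measure.quasiMeasurePreserving_snd.ae h'] with p hp hq using add_nonneg hp hq

lemma ae_nonneg_compoundPoisson {ν : Measure ℝ} [IsFiniteMeasure ν] (h : ∀ᵐ x ∂ν, 0 ≤ x) :
    ∀ᵐ x ∂(compoundPoisson ν), 0 ≤ x := by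
  unfold compoundPoisson
  rw [Measure.ae_sum_iff' (measurableSet_Ici (a := (0 : ℝ)))]
  intro k
  refine Measure.ae_smul_measure ?_ _
  induction k with
  | zero => simp [convPow]
  | succ k ih => exact ae_nonneg_conv h ih

/-- The compensated compound Poisson law with jump intensity `κ`, normalised so that the
exponential has mean one. -/
def martPoisson (κ : Measure ℝ) : Measure ℝ :=
  Measure.dirac (-∫ x, (Real.exp x - 1) ∂κ) ∗ compoundPoisson κ

instance isProbabilityMeasure_martPoisson (κ : Measure ℝ) [IsFiniteMeasure κ] :
    IsProbabilityMeasure (martPoisson κ) := by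
  unfold martPoisson; infer_instance

lemma hasExpMoment_martPoisson {κ : Measure ℝ} [IsFiniteMeasure κ] {z : ℂ}
    (hz : Integrable (fun x : ℝ => Complex.exp (z * x)) κ) (h1 : Integrable Real.exp κ) :
    HasExpMoment (martPoisson κ) z (Complex.exp
      (∫ x : ℝ, (Complex.exp (z * x) - 1 - z * ((Real.exp x - 1 : ℝ) : ℂ)) ∂κ)) := by
  have h := (hasExpMoment_dirac (-∫ x, (Real.exp x - 1) ∂κ) z).conv
    (hasExpMoment_compoundPoisson hz)
  rw [← Complex.exp_add] at h
  have hi : Integrable (fun x : ℝ => ((Real.exp x - 1 : ℝ) : ℂ)) κ :=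
    (h1.sub (integrable_const 1)).ofReal
  have e : ∫ x : ℝ, (Complex.exp (z * x) - 1 - z * ((Real.exp x - 1 : ℝ) : ℂ)) ∂κ
      = z * ((-∫ x, (Real.exp x - 1) ∂κ : ℝ) : ℂ) + ∫ x : ℝ, (Complex.exp (z * x) - 1) ∂κ := by
    have hz1 : Integrable (fun x : ℝ => Complex.exp (z * x) - 1) κ := hz.sub (integrable_const 1)
    rw [integral_sub hz1 (hi.const_mul z), integral_const_mul, integral_complex_ofReal]
    push_cast
    ring
  rw [e]
  exact h

lemma HasExpMoment.integrable_real {μ : Measure ℝ} {θ : ℝ} {w : ℂ} (h : HasExpMoment μ θ w) :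
    Integrable (fun x => Real.exp (θ * x)) μ := by
  simpa [Complex.norm_exp] using h.integrable.norm

lemma HasExpMoment.integral_real {μ : Measure ℝ} {θ m : ℝ} (h : HasExpMoment μ θ m) :
    ∫ x, Real.exp (θ * x) ∂μ = m := by
  have h1 := h.integral_eq
  have h2 : ∀ x : ℝ, Complex.exp (θ * x) = ((Real.exp (θ * x) : ℝ) : ℂ) := by simp
  simp_rw [h2, integral_complex_ofReal] at h1
  exact_mod_cast h1

/-! ### Comparison inequalities for put prices -/

/-- The put payoff with strike `K`, as a function of the log-price relative to `A`. -/
def putPayoff (K A x : ℝ) : ℝ := max (K - A * Real.exp x) 0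

lemma putPayoff_nonneg (K A x : ℝ) : 0 ≤ putPayoff K A x := le_max_right _ _

lemma putPayoff_le {K A : ℝ} (hK : 0 ≤ K) (hA : 0 ≤ A) (x : ℝ) : putPayoff K A x ≤ K :=
  max_le (by nlinarith [Real.exp_pos x, mul_nonneg hA (Real.exp_pos x).le]) hK

lemma continuous_putPayoff (K A : ℝ) : Continuous (putPayoff K A) := by
  unfold putPayoff; fun_prop

lemma integrable_putPayoff {K A : ℝ} (hK : 0 ≤ K) (hA : 0 ≤ A) (μ : Measure ℝ)
    [IsFiniteMeasure μ] : Integrable (putPayoff K A) μ := by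
  refine Integrable.of_bound (C := K) (continuous_putPayoff K A).aestronglyMeasurable
    (ae_of_all _ fun x => ?_)
  rw [Real.norm_eq_abs, abs_of_nonneg (putPayoff_nonneg K A x)]
  exact putPayoff_le hK hA x

lemma putPayoff_add (K A x y : ℝ) :
    putPayoff K A (x + y) = putPayoff K (A * Real.exp x) y := by
  unfold putPayoff; rw [Real.exp_add, mul_assoc]

/-- Put prices increase when an independent factor of mean one is added. -/
lemma integral_putPayoff_le_conv {K A : ℝ} (hK : 0 ≤ K) (hA : 0 ≤ A) (γ ρ : Measure ℝ)
    [IsProbabilityMeasure γ] [IsProbabilityMeasure ρ] (hρ : HasExpMoment ρ (1 : ℝ) (1 : ℝ)) :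
    ∫ x, putPayoff K A x ∂γ ≤ ∫ x, putPayoff K A x ∂(γ ∗ ρ) := by
  have hi := integrable_putPayoff hK hA (γ ∗ ρ)
  rw [integral_conv hi]
  refine integral_mono (integrable_putPayoff hK hA γ) ?_ fun x => ?_
  · have := hi
    unfold Measure.conv at this
    rw [integrable_map_measure hi.1 (by fun_prop)] at this
    exact this.integral_prod_left
  · simp_rw [putPayoff_add]
    set B := A * Real.exp x
    have hB : 0 ≤ B := mul_nonneg hA (Real.exp_pos x).le
    -- Jensen by hand: the conditional price is nonnegative, and it dominates K - B because the
    -- added factor has mean one.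
    refine max_le ?_ (integral_nonneg fun y => putPayoff_nonneg _ _ _)
    have he : Integrable (fun y => Real.exp y) ρ := by simpa using hρ.integrable_real
    have h1 : ∫ y, Real.exp y ∂ρ = 1 := by simpa using hρ.integral_real
    calc K - B = ∫ y, (K - B * Real.exp y) ∂ρ := by
          rw [integral_sub (integrable_const _) (he.const_mul _), integral_const_mul, h1]; simp
      _ ≤ _ := integral_mono ((integrable_const _).sub (he.const_mul _))
          (integrable_putPayoff hK hB ρ) fun y => le_max_left _ _

/-- Dropping nonnegative jumps (but not their compensator) increases put prices. -/
lemma integral_putPayoff_conv_martPoisson_le {K A : ℝ} (hK : 0 ≤ K) (hA : 0 ≤ A)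
    (U κ : Measure ℝ) [IsProbabilityMeasure U] [IsFiniteMeasure κ] (hκ : ∀ᵐ x ∂κ, 0 ≤ x) :
    ∫ x, putPayoff K A x ∂(U ∗ martPoisson κ)
      ≤ ∫ x, putPayoff K (A * Real.exp (-∫ x, (Real.exp x - 1) ∂κ)) x ∂U := by
  set c := -∫ x, (Real.exp x - 1) ∂κ with hc
  have hA' : 0 ≤ A * Real.exp c := mul_nonneg hA (Real.exp_pos c).le
  have hi := integrable_putPayoff hK hA (U ∗ martPoisson κ)
  rw [integral_conv hi]
  refine integral_mono ?_ (integrable_putPayoff hK hA' U) fun x => ?_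
  · have := hi
    unfold Measure.conv at this
    rw [integrable_map_measure hi.1 (by fun_prop)] at this
    exact this.integral_prod_left
  · simp_rw [putPayoff_add]
    have hB : 0 ≤ A * Real.exp x := mul_nonneg hA (Real.exp_pos x).le
    have hj := integrable_putPayoff hK hB (martPoisson κ)
    unfold martPoisson at hj ⊢
    rw [integral_conv hj, ← hc]
    simp only [integral_dirac]
    simp_rw [putPayoff_add]
    have hB' : 0 ≤ A * Real.exp x * Real.exp c := mul_nonneg hB (Real.exp_pos c).le
    calc _ ≤ ∫ _, putPayoff K (A * Real.exp c) x ∂(compoundPoisson κ) := by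
          refine integral_mono_ae (integrable_putPayoff hK hB' _) (integrable_const _) ?_
          filter_upwards [ae_nonneg_compoundPoisson hκ] with y hy
          refine max_le_max_right _ (sub_le_sub_left ?_ _)
          rw [mul_right_comm]
          exact le_mul_of_one_le_right hB' (Real.one_le_exp hy) |>.trans_eq' (by ring)
      _ = _ := by simp

/-- Bernoulli's inequality for (1 + s)^θ with s = e^w - 1. The gain 1/θ is essential: without it the
Chernoff bound would be τ^{a²/(2v)}, which beats τ only for a² > 2v. -/
lemma exp_sub_one_le_exp_mul_div {θ : ℝ} (hθ : 1 ≤ θ) (w : ℝ) :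
    Real.exp w - 1 ≤ Real.exp (θ * w) / θ := by
  rw [le_div_iff₀ (by linarith)]
  have h := one_add_mul_self_le_rpow_one_add (s := Real.exp w - 1)
    (by linarith [Real.exp_pos w]) hθ
  rw [add_sub_cancel, ← Real.exp_mul, mul_comm w θ] at h
  linarith

/-- Put-call parity together with an exponential Markov bound for the call. -/
lemma integral_putPayoff_le_chernoff {K a θ m : ℝ} (hK : 0 ≤ K) (hθ : 1 ≤ θ)
    (U : Measure ℝ) [IsProbabilityMeasure U] (h1 : HasExpMoment U (1 : ℝ) (1 : ℝ))
    (hm : HasExpMoment U θ m) :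
    ∫ x, putPayoff K (K * Real.exp a) x ∂U
      ≤ K - K * Real.exp a + K * (Real.exp (θ * a) * m / θ) := by
  have he : Integrable (fun y => Real.exp y) U := by simpa using h1.integrable_real
  have h1' : ∫ y, Real.exp y ∂U = 1 := by simpa using h1.integral_real
  have hpos : 0 < θ := by linarith
  have hi1 : Integrable (fun x => K - K * Real.exp a * Real.exp x) U :=
    (integrable_const _).sub (he.const_mul _)
  have hi2 : Integrable (fun x => K * Real.exp (θ * a) / θ * Real.exp (θ * x)) U :=
    hm.integrable_real.const_mul _
  calc _ ≤ ∫ x, ((K - K * Real.exp a * Real.exp x)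
        + K * Real.exp (θ * a) / θ * Real.exp (θ * x)) ∂U := by
        refine integral_mono (integrable_putPayoff hK (mul_nonneg hK (Real.exp_pos a).le) _)
          (hi1.add hi2) fun x => ?_
        have h := mul_le_mul_of_nonneg_left (exp_sub_one_le_exp_mul_div hθ (a + x)) hK
        rw [mul_add θ, Real.exp_add, Real.exp_add] at h
        have e : K * Real.exp (θ * a) / θ * Real.exp (θ * x)
          = K * (Real.exp (θ * a) * Real.exp (θ * x) / θ) := by ring
        have hn : 0 ≤ K * (Real.exp (θ * a) * Real.exp (θ * x) / θ) := by positivity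
        simp only [e]
        refine max_le (by linarith) (by nlinarith)
    _ = _ := by
        rw [integral_add hi1 hi2, integral_sub (integrable_const _) (he.const_mul _),
          integral_const_mul, integral_const_mul, h1', hm.integral_real]
        simp
        ring

/-! ### Integrability and the exponent in martingale form -/

section LevyMeasure

variable {ν : Measure ℝ}

lemma IsLevyMeasure.integrable_min (hν : IsLevyMeasure ν) :
    Integrable (fun z : ℝ => min 1 (z ^ 2)) ν := by
  refine ⟨by fun_prop, ?_⟩
  rw [hasFiniteIntegral_iff_ofReal (ae_of_all _ fun z => by positivity)]
  exact hν.lintegral_lt_top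

lemma IsLevyMeasure.measure_lt_top (hν : IsLevyMeasure ν) {ε : ℝ} (hε : 0 < ε) {S : Set ℝ}
    (hS : ∀ z ∈ S, ε ≤ |z|) : ν S < ∞ := by
  have hc : 0 < min 1 (ε ^ 2) := by positivity
  refine (measure_mono fun z hz => ?_).trans_lt (hν.integrable_min.measure_ge_lt_top hc)
  have : ε ^ 2 ≤ z ^ 2 := by
    rw [← sq_abs z]; exact pow_le_pow_left₀ hε.le (hS z hz) 2
  exact min_le_min_left _ this

/-- The integrand is quadratic for |z| ≤ 1, bounded for z < -1, and equal to the integrable e^z - 1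
for z > 1. -/
lemma IsLevyMeasure.integrable_exp_sub (hν : IsLevyMeasure ν)
    (hI : IntegrableOn (fun z => Real.exp z - 1) (Ioi 0) ν) :
    Integrable (fun z : ℝ => Real.exp z - 1 - (if |z| ≤ 1 then z else 0)) ν := by
  have hb := hν.integrable_min.add (hI.integrable_indicator measurableSet_Ioi)
  refine hb.mono' ?_ (ae_of_all _ fun z => ?_)
  · refine Measurable.aestronglyMeasurable ?_
    refine (by fun_prop : Measurable fun z : ℝ => Real.exp z - 1).sub ?_
    exact Measurable.ite (measurableSet_le (by fun_prop) (by fun_prop)) (by fun_prop) (by fun_prop)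
  · have hn : 0 ≤ (Ioi (0 : ℝ)).indicator (fun z => Real.exp z - 1) z :=
      indicator_nonneg (fun z hz => by
        have := Real.one_le_exp (le_of_lt (mem_Ioi.1 hz)); linarith) z
    simp only [Pi.add_apply, Real.norm_eq_abs]
    split_ifs with h
    · have h2 := Real.abs_exp_sub_one_sub_id_le h
      have h3 : z ^ 2 ≤ 1 := by rw [← sq_abs]; exact pow_le_one₀ (abs_nonneg z) h
      rw [min_eq_right h3]
      linarith
    · push Not at h
      have h3 : 1 ≤ z ^ 2 := by rw [← sq_abs]; exact one_le_pow₀ h.le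
      rw [min_eq_left h3]
      rcases lt_abs.1 h with h | h
      · have h0 : z ∈ Ioi (0 : ℝ) := by simp; linarith
        rw [indicator_of_mem h0, sub_zero, abs_of_nonneg]
        · linarith
        · have := Real.one_le_exp (x := z) (by linarith); linarith
      · have h4 : Real.exp z ≤ 1 := Real.exp_le_one_iff.2 (by linarith)
        rw [sub_zero, abs_of_nonpos (by linarith)]
        linarith [Real.exp_pos z]

lemma norm_exp_mul_I_sub_one_sub_le (x : ℝ) :
    ‖Complex.exp (Complex.I * x) - 1 - Complex.I * x‖ ≤ 3 * x ^ 2 := by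
  have hx : ‖Complex.I * (x : ℂ)‖ = |x| := by simp
  rcases le_or_gt |x| 1 with h | h
  · have := Complex.norm_exp_sub_one_sub_id_le (x := Complex.I * x) (by rwa [hx])
    rw [hx, sq_abs] at this
    nlinarith [sq_nonneg x]
  · have h1 : ‖Complex.exp (Complex.I * x) - 1‖ ≤ |x| := Real.norm_exp_I_mul_ofReal_sub_one_le
    have h2 := norm_sub_le (Complex.exp (Complex.I * x) - 1) (Complex.I * x)
    rw [hx] at h2
    rw [← sq_abs]
    nlinarith

lemma IsLevyMeasure.integrable_char_sub (hν : IsLevyMeasure ν) (u : ℝ) :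
    Integrable (fun z : ℝ => Complex.exp (Complex.I * u * z) - 1
        - Complex.I * u * ((if |z| ≤ 1 then z else 0 : ℝ) : ℂ)) ν := by
  have hb := hν.integrable_min.const_mul (3 * u ^ 2 + 2)
  refine hb.mono' ?_ (ae_of_all _ fun z => ?_)
  · refine Measurable.aestronglyMeasurable ?_
    refine (by fun_prop : Measurable fun z : ℝ => Complex.exp (Complex.I * u * z) - 1).sub ?_
    have : Measurable fun z : ℝ => (if |z| ≤ 1 then z else 0 : ℝ) :=
      Measurable.ite (measurableSet_le (by fun_prop) (by fun_prop)) (by fun_prop) (by fun_prop)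
    fun_prop
  · have e : Complex.I * u * z = Complex.I * ((u * z : ℝ) : ℂ) := by push_cast; ring
    split_ifs with h
    · have h2 := norm_exp_mul_I_sub_one_sub_le (u * z)
      have h3 : z ^ 2 ≤ 1 := by rw [← sq_abs]; exact pow_le_one₀ (abs_nonneg z) h
      rw [min_eq_right h3, e]
      nlinarith [sq_nonneg z]
    · push Not at h
      have h3 : 1 ≤ z ^ 2 := by rw [← sq_abs]; exact one_le_pow₀ h.le
      rw [min_eq_left h3, e]
      have h4 := norm_sub_le (Complex.exp (Complex.I * ((u * z : ℝ) : ℂ))) 1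
      rw [Complex.norm_exp_I_mul_ofReal, norm_one] at h4
      simp only [Complex.ofReal_zero, mul_zero, sub_zero]
      nlinarith [sq_nonneg u]

/-- The integrand of the exponent of the exponential-martingale Lévy process. -/
def martIntegrand (z : ℂ) (x : ℝ) : ℂ :=
  Complex.exp (z * x) - 1 - z * ((Real.exp x - 1 : ℝ) : ℂ)

lemma martIntegrand_eq (u x : ℝ) :
    martIntegrand (Complex.I * u) x
      = (Complex.exp (Complex.I * u * x) - 1
          - Complex.I * u * ((if |x| ≤ 1 then x else 0 : ℝ) : ℂ))
        - Complex.I * u * ((Real.exp x - 1 - (if |x| ≤ 1 then x else 0) : ℝ) : ℂ) := by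
  unfold martIntegrand
  push_cast
  ring

lemma IsLevyMeasure.integrable_martIntegrand (hν : IsLevyMeasure ν)
    (hI : IntegrableOn (fun z => Real.exp z - 1) (Ioi 0) ν) (u : ℝ) :
    Integrable (martIntegrand (Complex.I * u)) ν := by
  have h : martIntegrand (Complex.I * u) = _ := funext (martIntegrand_eq u)
  rw [h]
  exact (hν.integrable_char_sub u).sub ((hν.integrable_exp_sub hI).ofReal.const_mul _)

/-- The martingale drift exactly replaces the truncation compensator by e^x - 1. The exponent thus
splits into a Gaussian, a downward and an upward part, each vanishing at argument 1, that is, each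
of exponential mean one. -/
lemma levyExponent_eq {b v : ℝ} (hν : IsLevyMeasure ν) (hmart : MartingaleCondition b v ν)
    (hI : IntegrableOn (fun z => Real.exp z - 1) (Ioi 0) ν) (u : ℝ) :
    levyExponent b v ν u = (Complex.I * u) * ((-v / 2 : ℝ) : ℂ) + v * (Complex.I * u) ^ 2 / 2
      + ((∫ x in Iio 0, martIntegrand (Complex.I * u) x ∂ν)
        + ∫ x in Ioi 0, martIntegrand (Complex.I * u) x ∂ν) := by
  have hsplit : (∫ x in Iio 0, martIntegrand (Complex.I * u) x ∂ν)
        + ∫ x in Ioi 0, martIntegrand (Complex.I * u) x ∂ν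
      = ∫ x, martIntegrand (Complex.I * u) x ∂ν := by
    have hi := hν.integrable_martIntegrand hI u
    rw [← integral_add_compl (measurableSet_Iio (a := (0 : ℝ))) hi, compl_Iio]
    congr 1
    refine setIntegral_congr_set (Ioi_ae_eq_Ici' hν.zero)
  rw [hsplit]
  have hi : Integrable (fun x : ℝ => Complex.I * u *
      ((Real.exp x - 1 - (if |x| ≤ 1 then x else 0) : ℝ) : ℂ)) ν :=
    (hν.integrable_exp_sub hI).ofReal.const_mul _
  simp_rw [martIntegrand_eq]
  rw [integral_sub (hν.integrable_char_sub u) hi,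
    integral_const_mul, integral_complex_ofReal, levyExponent, hmart.drift]
  push_cast
  ring_nf
  simp only [Complex.I_sq]
  ring

lemma iUnion_Ioi_one_div : ⋃ n : ℕ, Ioi (1 / ((n : ℝ) + 1)) = Ioi 0 := by
  ext z
  simp only [mem_iUnion, mem_Ioi]
  exact ⟨fun ⟨n, hn⟩ => lt_trans (by positivity) hn, fun hz => exists_nat_one_div_lt hz⟩

lemma iUnion_Iio_neg_one_div : ⋃ n : ℕ, Iio (-(1 / ((n : ℝ) + 1))) = Iio 0 := by
  ext z
  simp only [mem_iUnion, mem_Iio]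
  refine ⟨fun ⟨n, hn⟩ => hn.trans (by rw [neg_lt_zero]; positivity), fun hz => ?_⟩
  obtain ⟨n, hn⟩ := exists_nat_one_div_lt (neg_pos.2 hz)
  exact ⟨n, by linarith⟩

/-- For negative jumps the exponential martingale exponent is `o(θ²)`. -/
lemma IsLevyMeasure.exists_exponent_bound (hν : IsLevyMeasure ν) {η : ℝ} (hη : 0 < η) :
    ∃ M : ℝ, 0 ≤ M ∧ ∀ S ⊆ Iio (0 : ℝ), MeasurableSet S → ∀ θ : ℝ, 1 ≤ θ →
      ∫ x in S, (Real.exp (θ * x) - 1 - θ * (Real.exp x - 1)) ∂ν ≤ η * θ ^ 2 + M * θ := by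
  -- Jumps close to 0 carry arbitrarily little of ∫ z² dν; they produce the ηθ² term. The remaining
  -- ones have finite mass and produce Mθ.
  have hlim : Tendsto (fun k : ℕ => ∫ z in Ioo (-(1 / ((k : ℝ) + 1))) 0, min 1 (z ^ 2) ∂ν) atTop
      (𝓝 0) := by
    have h := tendsto_setIntegral_of_antitone (μ := ν) (f := fun z : ℝ => min 1 (z ^ 2))
      (s := fun k : ℕ => Ioo (-(1 / ((k : ℝ) + 1))) 0) (fun k => measurableSet_Ioo)
      (fun i j hij => Ioo_subset_Ioo_left (neg_le_neg (Nat.one_div_le_one_div hij)))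
      ⟨0, hν.integrable_min.integrableOn⟩
    have he : ⋂ k : ℕ, Ioo (-(1 / ((k : ℝ) + 1))) 0 = ∅ := by
      refine eq_empty_of_forall_notMem fun z hz => ?_
      simp only [mem_iInter, mem_Ioo] at hz
      obtain ⟨n, hn⟩ := exists_nat_one_div_lt (neg_pos.2 (hz 0).2)
      linarith [(hz n).1]
    rwa [he, setIntegral_empty] at h
  obtain ⟨k, hk⟩ := (hlim.eventually_lt_const hη).exists
  set ε : ℝ := 1 / ((k : ℝ) + 1) with hε
  have hε0 : 0 < ε := by positivity
  have hε1 : ε ≤ 1 := by rw [hε, div_le_one (by positivity)]; simp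
  have hfin : ν (Iic (-ε)) < ∞ := hν.measure_lt_top hε0 fun z hz => by
    rw [le_abs]; right; linarith [mem_Iic.1 hz]
  refine ⟨ν.real (Iic (-ε)), measureReal_nonneg, fun S hS hSm θ hθ => ?_⟩
  have hi1 : Integrable ((Ioo (-ε) 0).indicator fun z => θ ^ 2 * min 1 (z ^ 2)) ν :=
    (hν.integrable_min.const_mul _).indicator measurableSet_Ioo
  have hi2 : Integrable ((Iic (-ε)).indicator fun _ => θ) ν :=
    (integrable_indicator_iff measurableSet_Iic).2 (integrableOn_const hfin.ne)
  have hn1 : ∀ z, 0 ≤ (Ioo (-ε) 0).indicator (fun z => θ ^ 2 * min 1 (z ^ 2)) z :=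
    fun z => indicator_nonneg (fun z _ => by positivity) z
  have hn2 : ∀ z, 0 ≤ (Iic (-ε)).indicator (fun _ => θ) z :=
    fun z => indicator_nonneg (fun z _ => by positivity) z
  calc _ ≤ ∫ x in S, ((Ioo (-ε) 0).indicator (fun z => θ ^ 2 * min 1 (z ^ 2)) x
        + (Iic (-ε)).indicator (fun _ => θ) x) ∂ν := by
        refine integral_mono_of_nonneg (ae_of_all _ fun x => ?_) (hi1.add hi2).integrableOn ?_
        · have h := one_add_mul_self_le_rpow_one_add (s := Real.exp x - 1)
            (by linarith [Real.exp_pos x]) hθ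
          rw [add_sub_cancel, ← Real.exp_mul, mul_comm x θ] at h
          simp only [Pi.zero_apply]
          linarith
        · filter_upwards [ae_restrict_mem hSm] with x hx
          have hx0 : x < 0 := hS hx
          rcases le_or_gt x (-ε) with h | h
          · rw [indicator_of_mem (mem_Iic.2 h)]
            have h1 : Real.exp (θ * x) ≤ 1 := Real.exp_le_one_iff.2 (by nlinarith)
            nlinarith [hn1 x, Real.exp_pos x, mul_pos (show 0 < θ by linarith) (Real.exp_pos x)]
          · rw [indicator_of_mem (mem_Ioo.2 ⟨h, hx0⟩)]
            have h3 : x ^ 2 ≤ 1 := by nlinarith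
            rw [min_eq_right h3]
            have h4 : Real.exp (θ * x) ≤ 1 + θ * x + (θ * x) ^ 2 := by
              have hy : θ * x ≤ 0 := by nlinarith
              rcases le_or_gt (-1) (θ * x) with h5 | h5
              · have := Real.abs_exp_sub_one_sub_id_le (abs_le.2 ⟨h5, by linarith⟩)
                linarith [(abs_le.1 this).2]
              · have := Real.exp_le_one_iff.2 hy
                nlinarith
            -- This cancels the linear term: θx ≤ θ(e^x - 1), leaving only θ²x².
            have h6 := Real.add_one_le_exp x
            nlinarith [hn2 x]
    _ ≤ ∫ x, ((Ioo (-ε) 0).indicator (fun z => θ ^ 2 * min 1 (z ^ 2)) x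
        + (Iic (-ε)).indicator (fun _ => θ) x) ∂ν :=
        setIntegral_le_integral (hi1.add hi2) (ae_of_all _ fun x => add_nonneg (hn1 x) (hn2 x))
    _ = θ ^ 2 * ∫ z in Ioo (-ε) 0, min 1 (z ^ 2) ∂ν + ν.real (Iic (-ε)) * θ := by
        rw [integral_add hi1 hi2, integral_indicator measurableSet_Ioo,
          integral_indicator measurableSet_Iic, integral_const_mul, setIntegral_const, smul_eq_mul]
    _ ≤ _ := by nlinarith [sq_nonneg θ]

/-! ### Approximation by laws without small jumps -/

/-- The intensity over a time span `τ` of the jumps with size in `S`. -/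
def jumpIntensity (ν : Measure ℝ) (τ : ℝ) (S : Set ℝ) : Measure ℝ :=
  ENNReal.ofReal τ • ν.restrict S

/-- The laws approximating that of an exponential-martingale Lévy process at time `τ`: the jumps
of size at most `1 / (n + 1)` are removed. -/
def approxLaw (ν : Measure ℝ) (v τ : ℝ) (n : ℕ) : Measure ℝ :=
  (gaussianReal (-v / 2 * τ) (v * τ).toNNReal
      ∗ martPoisson (jumpIntensity ν τ (Iio (-(1 / ((n : ℝ) + 1))))))
    ∗ martPoisson (jumpIntensity ν τ (Ioi (1 / ((n : ℝ) + 1))))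

lemma IsLevyMeasure.isFiniteMeasure_jumpIntensity_Iio (hν : IsLevyMeasure ν) (τ : ℝ) (n : ℕ) :
    IsFiniteMeasure (jumpIntensity ν τ (Iio (-(1 / ((n : ℝ) + 1))))) := by
  have : IsFiniteMeasure (ν.restrict (Iio (-(1 / ((n : ℝ) + 1))))) := by
    rw [isFiniteMeasure_restrict]
    refine (hν.measure_lt_top (ε := 1 / ((n : ℝ) + 1)) (by positivity) fun z hz => ?_).ne
    rw [le_abs]; right; linarith [mem_Iio.1 hz]
  exact Measure.smul_finite _ ENNReal.ofReal_ne_top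

lemma IsLevyMeasure.isFiniteMeasure_jumpIntensity_Ioi (hν : IsLevyMeasure ν) (τ : ℝ) (n : ℕ) :
    IsFiniteMeasure (jumpIntensity ν τ (Ioi (1 / ((n : ℝ) + 1)))) := by
  have : IsFiniteMeasure (ν.restrict (Ioi (1 / ((n : ℝ) + 1)))) := by
    rw [isFiniteMeasure_restrict]
    refine (hν.measure_lt_top (ε := 1 / ((n : ℝ) + 1)) (by positivity) fun z hz => ?_).ne
    rw [le_abs]; left; linarith [mem_Ioi.1 hz]
  exact Measure.smul_finite _ ENNReal.ofReal_ne_top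

lemma Iio_neg_one_div_subset (n : ℕ) : Iio (-(1 / ((n : ℝ) + 1))) ⊆ Iio 0 :=
  Iio_subset_Iio (by rw [neg_nonpos]; positivity)

lemma Ioi_one_div_subset (n : ℕ) : Ioi (1 / ((n : ℝ) + 1)) ⊆ Ioi 0 :=
  Ioi_subset_Ioi (by positivity)

lemma integrable_exp_mul_of_nonpos {κ : Measure ℝ} [IsFiniteMeasure κ] (hκ : ∀ᵐ x ∂κ, x ≤ 0)
    {θ : ℝ} (hθ : 0 ≤ θ) : Integrable (fun x => Real.exp (θ * x)) κ := by
  refine Integrable.of_bound (C := 1) (by fun_prop) ?_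
  filter_upwards [hκ] with x hx
  rw [Real.norm_eq_abs, Real.abs_exp, Real.exp_le_one_iff]
  exact mul_nonpos_of_nonneg_of_nonpos hθ hx

lemma ae_jumpIntensity {τ : ℝ} {S : Set ℝ} (hS : MeasurableSet S) :
    ∀ᵐ x ∂(jumpIntensity ν τ S), x ∈ S :=
  Measure.ae_smul_measure (ae_restrict_mem hS) _

lemma integral_jumpIntensity {E : Type*} [NormedAddCommGroup E] [NormedSpace ℝ E] {τ : ℝ}
    (hτ : 0 ≤ τ) (S : Set ℝ) (f : ℝ → E) :
    ∫ x, f x ∂(jumpIntensity ν τ S) = τ • ∫ x in S, f x ∂ν := by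
  rw [jumpIntensity, integral_smul_measure, ENNReal.toReal_ofReal hτ]

lemma integrable_exp_jumpIntensity_Iio (hν : IsLevyMeasure ν) (τ : ℝ) (n : ℕ) :
    Integrable Real.exp (jumpIntensity ν τ (Iio (-(1 / ((n : ℝ) + 1))))) := by
  have := hν.isFiniteMeasure_jumpIntensity_Iio τ n
  have h : ∀ᵐ x ∂(jumpIntensity ν τ (Iio (-(1 / ((n : ℝ) + 1))))), x ≤ 0 :=
    (ae_jumpIntensity measurableSet_Iio).mono fun x hx => le_of_lt (Iio_neg_one_div_subset n hx)
  simpa using integrable_exp_mul_of_nonpos h zero_le_one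

lemma integrable_exp_jumpIntensity_Ioi (hν : IsLevyMeasure ν)
    (hI : IntegrableOn (fun z => Real.exp z - 1) (Ioi 0) ν) (τ : ℝ) (n : ℕ) :
    Integrable Real.exp (jumpIntensity ν τ (Ioi (1 / ((n : ℝ) + 1)))) := by
  have := hν.isFiniteMeasure_jumpIntensity_Ioi τ n
  have h : Integrable (fun z => Real.exp z - 1) (jumpIntensity ν τ (Ioi (1 / ((n : ℝ) + 1)))) :=
    (hI.mono_set (Ioi_one_div_subset n)).integrable.smul_measure ENNReal.ofReal_ne_top
  exact (h.add (integrable_const (1 : ℝ))).congr (ae_of_all _ fun x => by simp)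

lemma isProbabilityMeasure_approxLaw (hν : IsLevyMeasure ν) (v τ : ℝ) (n : ℕ) :
    IsProbabilityMeasure (approxLaw ν v τ n) := by
  have := hν.isFiniteMeasure_jumpIntensity_Iio τ n
  have := hν.isFiniteMeasure_jumpIntensity_Ioi τ n
  unfold approxLaw
  infer_instance

lemma hasExpMoment_one_martPoisson {κ : Measure ℝ} [IsFiniteMeasure κ]
    (h1 : Integrable Real.exp κ) : HasExpMoment (martPoisson κ) (1 : ℝ) (1 : ℝ) := by
  have h := hasExpMoment_martPoisson (z := (1 : ℝ))
    ((integrable_norm_iff (by fun_prop)).1 (by simpa [Complex.norm_exp] using h1)) h1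
  simpa using h

lemma hasExpMoment_one_gaussian {v τ : ℝ} (hv : 0 ≤ v) (hτ : 0 ≤ τ) :
    HasExpMoment (gaussianReal (-v / 2 * τ) (v * τ).toNNReal) (1 : ℝ) (1 : ℝ) := by
  have h := hasExpMoment_gaussianReal (-v / 2 * τ) (v * τ).toNNReal (1 : ℝ)
  have hc : (((v * τ).toNNReal : ℝ) : ℂ) = ((v * τ : ℝ) : ℂ) := by
    rw [Real.coe_toNNReal _ (mul_nonneg hv hτ)]
  rw [hc] at h
  convert h using 1
  rw [eq_comm, Complex.ofReal_one, Complex.exp_eq_one_iff]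
  exact ⟨0, by push_cast; ring⟩

lemma charFun_eq_of_hasExpMoment {μ : Measure ℝ} {u : ℝ} {w : ℂ}
    (h : HasExpMoment μ (Complex.I * u) w) : charFun μ u = w := by
  rw [charFun_apply_real, ← h.integral_eq]
  congr 1
  ext x
  ring_nf

lemma integrable_exp_I_mul (κ : Measure ℝ) [IsFiniteMeasure κ] (u : ℝ) :
    Integrable (fun x : ℝ => Complex.exp (Complex.I * u * x)) κ := by
  refine Integrable.of_bound (C := 1) (by fun_prop) (ae_of_all _ fun x => ?_)
  rw [mul_assoc, ← Complex.ofReal_mul, Complex.norm_exp_I_mul_ofReal]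

lemma charFun_approxLaw (hν : IsLevyMeasure ν)
    (hI : IntegrableOn (fun z => Real.exp z - 1) (Ioi 0) ν) {v τ : ℝ} (hv : 0 ≤ v) (hτ : 0 ≤ τ)
    (n : ℕ) (u : ℝ) :
    charFun (approxLaw ν v τ n) u = Complex.exp (τ *
      ((Complex.I * u) * ((-v / 2 : ℝ) : ℂ) + v * (Complex.I * u) ^ 2 / 2
      + ((∫ x in Iio (-(1 / ((n : ℝ) + 1))), martIntegrand (Complex.I * u) x ∂ν)
        + ∫ x in Ioi (1 / ((n : ℝ) + 1)), martIntegrand (Complex.I * u) x ∂ν))) := by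
  have := hν.isFiniteMeasure_jumpIntensity_Iio τ n
  have := hν.isFiniteMeasure_jumpIntensity_Ioi τ n
  refine charFun_eq_of_hasExpMoment ?_
  have h := ((hasExpMoment_gaussianReal (-v / 2 * τ) (v * τ).toNNReal (Complex.I * u)).conv
    (hasExpMoment_martPoisson (integrable_exp_I_mul _ u)
      (integrable_exp_jumpIntensity_Iio hν τ n))).conv
    (hasExpMoment_martPoisson (integrable_exp_I_mul _ u)
      (integrable_exp_jumpIntensity_Ioi hν hI τ n))
  have hc : (((v * τ).toNNReal : ℝ) : ℂ) = ((v * τ : ℝ) : ℂ) := by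
    rw [Real.coe_toNNReal _ (mul_nonneg hv hτ)]
  rw [hc, ← Complex.exp_add, ← Complex.exp_add] at h
  have e1 := integral_jumpIntensity (ν := ν) hτ (Iio (-(1 / ((n : ℝ) + 1))))
    (martIntegrand (Complex.I * u))
  have e2 := integral_jumpIntensity (ν := ν) hτ (Ioi (1 / ((n : ℝ) + 1)))
    (martIntegrand (Complex.I * u))
  simp only [martIntegrand, Complex.real_smul] at e1 e2
  rw [e1, e2] at h
  simp only [martIntegrand]
  unfold approxLaw
  have key : ∀ a b : ℂ, (Complex.I * u * ((-v / 2 * τ : ℝ) : ℂ) +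
      ((v * τ : ℝ) : ℂ) * (Complex.I * u) ^ 2 / 2 + τ * a + τ * b)
      = τ * ((Complex.I * u) * ((-v / 2 : ℝ) : ℂ) + v * (Complex.I * u) ^ 2 / 2 + (a + b)) := by
    intro a b; push_cast; ring
  rw [key] at h
  exact h

/-- Put prices under the approximating laws converge to those under the limit law. -/
lemma tendsto_integral_putPayoff (hν : IsLevyMeasure ν)
    (hI : IntegrableOn (fun z => Real.exp z - 1) (Ioi 0) ν) {b v τ : ℝ} (hv : 0 ≤ v) (hτ : 0 ≤ τ)
    (hmart : MartingaleCondition b v ν) (μ : Measure ℝ) [IsProbabilityMeasure μ]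
    (hμ : ∀ u, charFun μ u = Complex.exp (τ * levyExponent b v ν u)) {K A : ℝ}
    (hK : 0 ≤ K) (hA : 0 ≤ A) :
    Tendsto (fun n => ∫ x, putPayoff K A x ∂(approxLaw ν v τ n)) atTop
      (𝓝 (∫ x, putPayoff K A x ∂μ)) := by
  let μn : ℕ → ProbabilityMeasure ℝ := fun n =>
    ⟨approxLaw ν v τ n, isProbabilityMeasure_approxLaw hν v τ n⟩
  let μ0 : ProbabilityMeasure ℝ := ⟨μ, inferInstance⟩
  have hlim : Tendsto μn atTop (𝓝 μ0) := by
    -- Lévy's continuity theorem: the truncated exponents converge because the jump sizes retained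
    -- exhaust both half-lines.
    refine ProbabilityMeasure.tendsto_of_tendsto_charFun fun u => ?_
    change Tendsto (fun n => charFun (approxLaw ν v τ n) u) atTop (𝓝 (charFun μ u))
    rw [hμ u, levyExponent_eq hν hmart hI u]
    simp_rw [charFun_approxLaw hν hI hv hτ]
    have hi := hν.integrable_martIntegrand hI u
    have h1 := tendsto_setIntegral_of_monotone (μ := ν) (f := martIntegrand (Complex.I * u))
      (s := fun n : ℕ => Iio (-(1 / ((n : ℝ) + 1)))) (fun n => measurableSet_Iio)
      (fun i j hij => Iio_subset_Iio (neg_le_neg (Nat.one_div_le_one_div hij))) hi.integrableOn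
    have h2 := tendsto_setIntegral_of_monotone (μ := ν) (f := martIntegrand (Complex.I * u))
      (s := fun n : ℕ => Ioi (1 / ((n : ℝ) + 1))) (fun n => measurableSet_Ioi)
      (fun i j hij => Ioi_subset_Ioi (Nat.one_div_le_one_div hij)) hi.integrableOn
    rw [iUnion_Iio_neg_one_div] at h1
    rw [iUnion_Ioi_one_div] at h2
    exact (Complex.continuous_exp.tendsto _).comp
      (((h1.add h2).const_add _).const_mul _)
  rw [ProbabilityMeasure.tendsto_iff_forall_integral_tendsto] at hlim
  exact hlim (BoundedContinuousFunction.ofNormedAddCommGroup (putPayoff K A)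
    (continuous_putPayoff K A) K fun x => by
      rw [Real.norm_eq_abs, abs_of_nonneg (putPayoff_nonneg K A x)]
      exact putPayoff_le hK hA x)

/-! ### Lower and upper bounds for put prices -/

/-- Put prices dominate the corresponding Gaussian put prices. -/
lemma gaussian_put_le (hν : IsLevyMeasure ν)
    (hI : IntegrableOn (fun z => Real.exp z - 1) (Ioi 0) ν) {b v τ : ℝ} (hv : 0 ≤ v) (hτ : 0 ≤ τ)
    (hmart : MartingaleCondition b v ν) (μ : Measure ℝ) [IsProbabilityMeasure μ]
    (hμ : ∀ u, charFun μ u = Complex.exp (τ * levyExponent b v ν u)) {K A : ℝ}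
    (hK : 0 ≤ K) (hA : 0 ≤ A) :
    ∫ x, putPayoff K A x ∂(gaussianReal (-v / 2 * τ) (v * τ).toNNReal)
      ≤ ∫ x, putPayoff K A x ∂μ := by
  refine ge_of_tendsto (tendsto_integral_putPayoff hν hI hv hτ hmart μ hμ hK hA)
    (Eventually.of_forall fun n => ?_)
  have := hν.isFiniteMeasure_jumpIntensity_Iio τ n
  have := hν.isFiniteMeasure_jumpIntensity_Ioi τ n
  unfold approxLaw
  exact (integral_putPayoff_le_conv hK hA _ _ (hasExpMoment_one_martPoisson
      (integrable_exp_jumpIntensity_Iio hν τ n))).trans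
    (integral_putPayoff_le_conv hK hA _ _ (hasExpMoment_one_martPoisson
      (integrable_exp_jumpIntensity_Ioi hν hI τ n)))

/-- An upper bound for put prices: the upward jumps cost at most their compensator, and the rest
is controlled by an exponential moment. -/
lemma put_le_of_exponent_bound (hν : IsLevyMeasure ν)
    (hI : IntegrableOn (fun z => Real.exp z - 1) (Ioi 0) ν) {b v τ : ℝ} (hv : 0 ≤ v) (hτ : 0 ≤ τ)
    (hmart : MartingaleCondition b v ν) (μ : Measure ℝ) [IsProbabilityMeasure μ]
    (hμ : ∀ u, charFun μ u = Complex.exp (τ * levyExponent b v ν u)) {K a θ B : ℝ}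
    (hK : 0 ≤ K) (hθ : 1 ≤ θ)
    (hB : ∀ S ⊆ Iio (0 : ℝ), MeasurableSet S →
      ∫ x in S, (Real.exp (θ * x) - 1 - θ * (Real.exp x - 1)) ∂ν ≤ B) :
    ∫ x, putPayoff K (K * Real.exp a) x ∂μ
      ≤ K - K * Real.exp (a - τ * ∫ x in Ioi 0, (Real.exp x - 1) ∂ν)
        + K * (Real.exp (θ * a + τ * (v / 2 * θ ^ 2 + B)) / θ) := by
  refine le_of_tendsto (tendsto_integral_putPayoff hν hI hv hτ hmart μ hμ hK
    (mul_nonneg hK (Real.exp_pos a).le)) (Eventually.of_forall fun n => ?_)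
  have := hν.isFiniteMeasure_jumpIntensity_Iio τ n
  have := hν.isFiniteMeasure_jumpIntensity_Ioi τ n
  have hpos : 0 < θ := by linarith
  unfold approxLaw
  refine (integral_putPayoff_conv_martPoisson_le hK (mul_nonneg hK (Real.exp_pos a).le) _ _
    ((ae_jumpIntensity measurableSet_Ioi).mono fun x hx =>
      le_of_lt (Ioi_one_div_subset n hx))).trans ?_
  rw [integral_jumpIntensity hτ, smul_eq_mul, mul_assoc, ← Real.exp_add]
  have hexp := integrable_exp_jumpIntensity_Iio hν τ n
  set κ := jumpIntensity ν τ (Iio (-(1 / ((n : ℝ) + 1)))) with hκ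
  have hneg : ∀ᵐ x ∂κ, x ≤ 0 :=
    (ae_jumpIntensity measurableSet_Iio).mono fun x hx => le_of_lt (Iio_neg_one_div_subset n hx)
  set J := ∫ x in Ioi (1 / ((n : ℝ) + 1)), (Real.exp x - 1) ∂ν
  have hnn : ∀ᵐ x ∂(ν.restrict (Ioi 0)), 0 ≤ Real.exp x - 1 := by
    filter_upwards [ae_restrict_mem measurableSet_Ioi] with x hx
    linarith [Real.one_le_exp (le_of_lt (mem_Ioi.1 hx))]
  have hJ : J ≤ ∫ x in Ioi 0, (Real.exp x - 1) ∂ν :=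
    setIntegral_mono_set hI hnn (Ioi_one_div_subset n).eventuallyLE
  have hJ0 : 0 ≤ J := setIntegral_nonneg measurableSet_Ioi fun x hx => by
    linarith [Real.one_le_exp (le_of_lt (mem_Ioi.1 (Ioi_one_div_subset n hx)))]
  set Q := ∫ x in Iio (-(1 / ((n : ℝ) + 1))), (Real.exp (θ * x) - 1 - θ * (Real.exp x - 1)) ∂ν
    with hQ
  have hQB : Q ≤ B := hB _ (Iio_neg_one_div_subset n) measurableSet_Iio
  have hmom : HasExpMoment (gaussianReal (-v / 2 * τ) (v * τ).toNNReal ∗ martPoisson κ) θ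
      ((Real.exp (τ * (v / 2 * (θ ^ 2 - θ) + Q)) : ℝ) : ℂ) := by
    have h := (hasExpMoment_gaussianReal (-v / 2 * τ) (v * τ).toNNReal θ).conv
      (hasExpMoment_martPoisson (κ := κ) (z := θ)
        ((integrable_norm_iff (by fun_prop)).1 (by
          simpa [Complex.norm_exp] using integrable_exp_mul_of_nonpos hneg hpos.le)) hexp)
    have hc : (((v * τ).toNNReal : ℝ) : ℂ) = ((v * τ : ℝ) : ℂ) := by
      rw [Real.coe_toNNReal _ (mul_nonneg hv hτ)]
    have e : ∫ x : ℝ, (Complex.exp (θ * x) - 1 - θ * ((Real.exp x - 1 : ℝ) : ℂ)) ∂κ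
        = ((τ * Q : ℝ) : ℂ) := by
      rw [hκ, integral_jumpIntensity hτ, Complex.real_smul, Complex.ofReal_mul, hQ,
        ← integral_complex_ofReal]
      simp
    rw [hc, e, ← Complex.exp_add] at h
    convert h using 1
    rw [Complex.ofReal_exp]
    congr 1
    push_cast
    ring
  refine (integral_putPayoff_le_chernoff hK hθ _ (by
    simpa using (hasExpMoment_one_gaussian hv hτ).conv (hasExpMoment_one_martPoisson hexp))
    hmom).trans ?_
  have h1 : K * Real.exp (a - τ * ∫ x in Ioi 0, (Real.exp x - 1) ∂ν)
      ≤ K * Real.exp (a + -(τ * J)) := by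
    refine mul_le_mul_of_nonneg_left (Real.exp_le_exp.2 ?_) hK
    linarith [mul_le_mul_of_nonneg_left hJ hτ]
  have h2 : K * (Real.exp (θ * (a + -(τ * J))) * Real.exp (τ * (v / 2 * (θ ^ 2 - θ) + Q)) / θ)
      ≤ K * (Real.exp (θ * a + τ * (v / 2 * θ ^ 2 + B)) / θ) := by
    refine mul_le_mul_of_nonneg_left ?_ hK
    refine div_le_div_of_nonneg_right ?_ hpos.le
    rw [← Real.exp_add, Real.exp_le_exp]
    -- Two favourable terms of the exponent are thrown away: the compensator of the upward jumps and
    -- the Gaussian mean correction.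
    have i1 : 0 ≤ θ * (τ * J) := by positivity
    have i2 : 0 ≤ τ * (v / 2 * θ) := by positivity
    nlinarith [mul_le_mul_of_nonneg_left hQB hτ]
  linarith

end LevyMeasure

/-! ### Gaussian lower bounds -/

/-- Mass of an interval to the right of the mean under a Gaussian law. -/
lemma gaussianReal_Icc_ge {m : ℝ} {v : ℝ≥0} (hv : v ≠ 0) {α β : ℝ} (hm : m ≤ α) (hαβ : α ≤ β) :
    (β - α) * gaussianPDFReal m v β ≤ (gaussianReal m v).real (Icc α β) := by
  rw [measureReal_def, gaussianReal_apply_eq_integral m hv, ENNReal.toReal_ofReal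
    (integral_nonneg fun x => gaussianPDFReal_nonneg m v x)]
  calc (β - α) * gaussianPDFReal m v β = ∫ _ in Icc α β, gaussianPDFReal m v β := by
        rw [setIntegral_const, measureReal_def, Real.volume_Icc,
          ENNReal.toReal_ofReal (by linarith), smul_eq_mul]
    _ ≤ _ := by
        refine setIntegral_mono_on (by simp)
          (integrable_gaussianPDFReal m v).integrableOn measurableSet_Icc fun x hx => ?_
        unfold gaussianPDFReal
        refine mul_le_mul_of_nonneg_left (Real.exp_le_exp.2 ?_) (by positivity)
        refine div_le_div_of_nonneg_right ?_ (by positivity)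
        have h1 : 0 ≤ x - m := by linarith [hx.1]
        have h2 : x - m ≤ β - m := by linarith [hx.2]
        exact neg_le_neg (pow_le_pow_left₀ h1 h2 2)

/-- A lower bound for Gaussian put prices. -/
lemma gaussian_put_ge {K v τ q h : ℝ} (hK : 0 ≤ K) (hv : 0 < v) (hτ : 0 < τ) (hq : 0 ≤ q)
    (hh : 0 ≤ h) :
    K - K * Real.exp (-q) + K * (h ^ 2 * ((√(2 * Real.pi * (v * τ)))⁻¹ *
        Real.exp (-(q + 2 * h + v * τ / 2) ^ 2 / (2 * (v * τ)))))
      ≤ ∫ x, putPayoff K (K * Real.exp (-q)) x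
          ∂(gaussianReal (-v / 2 * τ) (v * τ).toNNReal) := by
  set γ := gaussianReal (-v / 2 * τ) (v * τ).toNNReal with hγ
  have hvτ : 0 < v * τ := mul_pos hv hτ
  have hv0 : (v * τ).toNNReal ≠ 0 := by simpa using hvτ
  have h1 := hasExpMoment_one_gaussian hv.le hτ.le
  have he : Integrable (fun y => Real.exp y) γ := by simpa using h1.integrable_real
  have h1' : ∫ y, Real.exp y ∂γ = 1 := by simpa using h1.integral_real
  have hi1 : Integrable (fun x => K - K * Real.exp (-q) * Real.exp x) γ :=
    (integrable_const _).sub (he.const_mul _)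
  have hi2 : Integrable ((Icc (q + h) (q + 2 * h)).indicator fun _ => K * h) γ :=
    (integrable_const _).indicator measurableSet_Icc
  have hm := gaussianReal_Icc_ge (m := -v / 2 * τ) hv0 (α := q + h) (β := q + 2 * h)
    (by nlinarith) (by linarith)
  have hpdf : gaussianPDFReal (-v / 2 * τ) (v * τ).toNNReal (q + 2 * h)
      = (√(2 * Real.pi * (v * τ)))⁻¹ *
        Real.exp (-(q + 2 * h + v * τ / 2) ^ 2 / (2 * (v * τ))) := by
    unfold gaussianPDFReal
    rw [Real.coe_toNNReal _ hvτ.le]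
    congr 3
    ring
  rw [hpdf] at hm
  set g := (√(2 * Real.pi * (v * τ)))⁻¹ *
        Real.exp (-(q + 2 * h + v * τ / 2) ^ 2 / (2 * (v * τ)))
  calc _ ≤ K - K * Real.exp (-q) + γ.real (Icc (q + h) (q + 2 * h)) * (K * h) := by
        have := mul_le_mul_of_nonneg_right hm (mul_nonneg hK hh)
        nlinarith
    _ = ∫ x, ((K - K * Real.exp (-q) * Real.exp x)
        + (Icc (q + h) (q + 2 * h)).indicator (fun _ => K * h) x) ∂γ := by
        rw [integral_add hi1 hi2, integral_sub (integrable_const _) (he.const_mul _),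
          integral_const_mul, h1', integral_indicator measurableSet_Icc, setIntegral_const]
        simp
    _ ≤ _ := by
        refine integral_mono (hi1.add hi2)
          (integrable_putPayoff hK (mul_nonneg hK (Real.exp_pos _).le) _) fun x => ?_
        simp only [putPayoff]
        by_cases hx : x ∈ Icc (q + h) (q + 2 * h)
        · rw [indicator_of_mem hx]
          -- Here e^{x-q} - 1 ≥ x - q ≥ h, so the linear payoff plus K h is still at most 0.
          refine le_max_of_le_right ?_
          rw [mul_assoc, ← Real.exp_add]
          have := Real.add_one_le_exp (-q + x)
          have hx1 := hx.1
          nlinarith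
        · rw [indicator_of_notMem hx, add_zero]
          exact le_max_left _ _

/-! ### Asymptotics in τ -/

lemma tendsto_sqrt_neg_mul_log :
    Tendsto (fun τ : ℝ => √(-(τ * Real.log τ))) (𝓝[>] 0) (𝓝 0) := by
  have h : Continuous fun τ : ℝ => √(-(τ * Real.log τ)) :=
    Real.continuous_sqrt.comp Real.continuous_mul_log.neg
  simpa using (h.tendsto 0).mono_left nhdsWithin_le_nhds

lemma eventually_log_le (c : ℝ) : ∀ᶠ τ : ℝ in 𝓝[>] 0, Real.log τ ≤ c :=
  Real.tendsto_log_nhdsGT_zero.eventually_le_atBot c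

lemma eventually_mul_le {c : ℝ} (hc : 0 < c) (C : ℝ) :
    ∀ᶠ τ : ℝ in 𝓝[>] 0, C * τ ≤ c := by
  have h : Tendsto (fun τ : ℝ => C * τ) (𝓝[>] 0) (𝓝 0) := by
    have : Continuous fun τ : ℝ => C * τ := by fun_prop
    simpa using (this.tendsto 0).mono_left nhdsWithin_le_nhds
  exact h.eventually_le_const hc

lemma sqrt_neg_mul_log_sq {τ : ℝ} (h0 : 0 ≤ τ) (h : Real.log τ ≤ 0) :
    √(-(τ * Real.log τ)) ^ 2 = τ * -Real.log τ := by
  rw [Real.sq_sqrt (by nlinarith)]; ring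

lemma rpow_half_le_sqrt_neg_mul_log {τ : ℝ} (h0 : 0 ≤ τ) (h : Real.log τ ≤ -1) :
    τ ^ (1 / 2 : ℝ) ≤ √(-(τ * Real.log τ)) := by
  rw [← Real.sqrt_eq_rpow]
  exact Real.sqrt_le_sqrt (by nlinarith)

/-- `C τ` is eventually below any multiple of `√(-τ log τ)`. -/
lemma eventually_mul_le_mul_sqrt {ε : ℝ} (hε : 0 < ε) {C : ℝ} (hC : 0 ≤ C) :
    ∀ᶠ τ : ℝ in 𝓝[>] 0, C * τ ≤ ε * √(-(τ * Real.log τ)) := by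
  have h := tendsto_sqrt_neg_mul_log.const_mul C
  rw [mul_zero] at h
  filter_upwards [h.eventually_le_const hε, eventually_log_le (-1), self_mem_nhdsWithin]
    with τ h1 h2 h3
  have h0 : 0 < τ := h3
  set y := √(-(τ * Real.log τ)) with hy
  have hy2 : y ^ 2 = τ * -Real.log τ := sqrt_neg_mul_log_sq h0.le (by linarith)
  have hy0 : 0 ≤ y := Real.sqrt_nonneg _
  have h4 : τ ≤ y ^ 2 := by rw [hy2]; nlinarith
  nlinarith [mul_le_mul_of_nonneg_left h4 hC, mul_le_mul_of_nonneg_right h1 hy0]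

/-- The Chernoff term is negligible with respect to `τ` above the critical level. -/
lemma eventually_chernoff_le {a v d C : ℝ} (ha : 0 < a) (hv : 0 < v) (hav : v < a ^ 2)
    (hd : 0 < d) :
    ∀ᶠ τ : ℝ in 𝓝[>] 0, ∃ θ : ℝ, 1 ≤ θ ∧
      Real.exp (-θ * (a * √(-(τ * Real.log τ))) + τ * (v / 2 * θ ^ 2 + C * θ)) / θ
        ≤ Real.exp (-(a * √(-(τ * Real.log τ)))) * (d * τ) := by
  set p := a ^ 2 / (2 * v) with hp
  have hp2 : 1 / 2 < p := by rw [hp, div_lt_div_iff₀ two_pos (by positivity)]; linarith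
  set c := a / v with hc
  have hc0 : 0 < c := div_pos ha hv
  have hlim : Tendsto (fun τ : ℝ => τ ^ (p - 1 / 2) *
      (Real.exp ((C * c + a) * √(-(τ * Real.log τ))) / c)) (𝓝[>] 0) (𝓝 0) := by
    have h1 : Tendsto (fun τ : ℝ => τ ^ (p - 1 / 2)) (𝓝[>] 0) (𝓝 0) := by
      have := (Real.continuousAt_rpow_const 0 (p - 1 / 2) (Or.inr (by linarith))).tendsto
      rw [Real.zero_rpow (by linarith)] at this
      exact this.mono_left nhdsWithin_le_nhds
    have h2 := (tendsto_sqrt_neg_mul_log.const_mul (C * c + a)).rexp.div_const c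
    simpa using h1.mul h2
  filter_upwards [hlim.eventually_le_const hd, eventually_log_le (-1), self_mem_nhdsWithin,
    eventually_mul_le_mul_sqrt hc0 zero_le_one] with τ h1 h2 h3 h4
  have h0 : 0 < τ := h3
  have hyh := rpow_half_le_sqrt_neg_mul_log h0.le h2
  set y := √(-(τ * Real.log τ)) with hy
  have hy2 : y ^ 2 = τ * -Real.log τ := sqrt_neg_mul_log_sq h0.le (by linarith)
  have hy0 : 0 < y := lt_of_lt_of_le (Real.rpow_pos_of_pos h0 _) hyh
  -- With c = a / v this θ minimises -θay + τvθ²/2; the minimum is p ln τ because y²/τ = -ln τ.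
  refine ⟨c * y / τ, by rw [le_div_iff₀ h0]; exact h4, ?_⟩
  have e1 : -(c * y / τ) * (a * y) + τ * (v / 2 * (c * y / τ) ^ 2 + C * (c * y / τ))
      = Real.log τ * p + C * c * y := by
    have : -(c * y / τ) * (a * y) + τ * (v / 2 * (c * y / τ) ^ 2 + C * (c * y / τ))
      = (y ^ 2 / τ) * (-(c * a) + v / 2 * c ^ 2) + C * c * y := by
      field_simp
      ring
    rw [this, hy2, mul_div_cancel_left₀ _ h0.ne', hc, hp]
    field_simp
    ring
  rw [e1, Real.exp_add, ← Real.rpow_def_of_pos h0]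
  -- Dividing by θ supplies τ/y. As y ≥ τ^{1/2}, the ratio to τ is at most of order τ^{p - 1/2},
  -- which tends to 0.
  have e2 : τ ^ p * Real.exp (C * c * y) / (c * y / τ)
      = Real.exp (-(a * y)) * ((τ ^ p / y * (Real.exp ((C * c + a) * y) / c)) * τ) := by
    have : Real.exp ((C * c + a) * y) = Real.exp (C * c * y) * Real.exp (a * y) := by
      rw [← Real.exp_add]; ring_nf
    rw [this, Real.exp_neg]
    field_simp
  rw [e2]
  refine mul_le_mul_of_nonneg_left (mul_le_mul_of_nonneg_right ?_ h0.le) (Real.exp_pos _).le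
  refine le_trans (mul_le_mul_of_nonneg_right ?_ (by positivity)) h1
  rw [div_le_iff₀ hy0]
  calc τ ^ p = τ ^ (p - 1 / 2) * τ ^ (1 / 2 : ℝ) := by rw [← Real.rpow_add h0]; ring_nf
    _ ≤ _ := by gcongr

/-- The Gaussian term dominates any multiple of `τ` below the critical level. -/
lemma eventually_lt_gaussian {a' v ε C : ℝ} (hv : 0 < v) (hav : a' ^ 2 < v) (hε : 0 < ε) :
    ∀ᶠ τ : ℝ in 𝓝[>] 0, C * τ < (ε * √(-(τ * Real.log τ))) ^ 2 *
      ((√(2 * Real.pi * (v * τ)))⁻¹ *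
        Real.exp (-(a' * √(-(τ * Real.log τ))) ^ 2 / (2 * (v * τ)))) := by
  set p := a' ^ 2 / (2 * v) with hp
  have hp2 : p < 1 / 2 := by rw [hp, div_lt_div_iff₀ (by positivity) two_pos]; linarith
  have hs : 0 < √(2 * Real.pi * v) := Real.sqrt_pos.2 (by positivity)
  have hlim : Tendsto (fun τ : ℝ => ε ^ 2 * (√(2 * Real.pi * v))⁻¹ * τ ^ (p - 1 / 2))
      (𝓝[>] 0) atTop :=
    (tendsto_rpow_neg_nhdsGT_zero (by linarith)).const_mul_atTop (by positivity)
  filter_upwards [hlim.eventually_gt_atTop C, eventually_log_le (-1), self_mem_nhdsWithin]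
    with τ h1 h2 h3
  have h0 : 0 < τ := h3
  set y := √(-(τ * Real.log τ)) with hy
  have hy2 : y ^ 2 = τ * -Real.log τ := sqrt_neg_mul_log_sq h0.le (by linarith)
  have e1 : -(a' * y) ^ 2 / (2 * (v * τ)) = Real.log τ * p := by
    rw [mul_pow, hy2, hp]; field_simp
  have e2 : √(2 * Real.pi * (v * τ)) = √(2 * Real.pi * v) * τ ^ (1 / 2 : ℝ) := by
    rw [← mul_assoc, Real.sqrt_mul (by positivity), ← Real.sqrt_eq_rpow]
  rw [e1, ← Real.rpow_def_of_pos h0, e2, mul_pow, hy2]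
  have e3 : ε ^ 2 * (τ * -Real.log τ) * ((√(2 * Real.pi * v) * τ ^ (1 / 2 : ℝ))⁻¹ * τ ^ p)
      = (ε ^ 2 * (√(2 * Real.pi * v))⁻¹ * τ ^ (p - 1 / 2)) * τ * -Real.log τ := by
    rw [Real.rpow_sub h0, mul_inv]
    field_simp
  rw [e3]
  set Z := ε ^ 2 * (√(2 * Real.pi * v))⁻¹ * τ ^ (p - 1 / 2)
  have hZ : 0 < Z := by positivity
  nlinarith [mul_pos hZ h0, mul_lt_mul_of_pos_right h1 h0]

/-! ### The constant d and the critical price -/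

/-- Positivity of `dConst` makes the upward jumps of finite exponential variation, with mean rate
below `r - δ`. -/
lemma integrableOn_and_lt_of_dConst_pos {r δ : ℝ} {ν : Measure ℝ} (hd : 0 < dConst r δ ν) :
    IntegrableOn (fun z => Real.exp z - 1) (Ioi 0) ν ∧
      ∫ z in Ioi 0, (Real.exp z - 1) ∂ν < r - δ := by
  have hnn : 0 ≤ᵐ[ν.restrict (Ioi 0)] fun z => Real.exp z - 1 := by
    filter_upwards [ae_restrict_mem measurableSet_Ioi] with x hx
    simp only [Pi.zero_apply]
    linarith [Real.one_le_exp (le_of_lt (mem_Ioi.1 hx))]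
  unfold dConst at hd
  set J := ∫⁻ z in Ioi (0 : ℝ), ENNReal.ofReal (Real.exp z - 1) ∂ν with hJ
  have hJtop : J ≠ ∞ := by
    intro h
    rw [h] at hd
    simp at hd
  have hint : IntegrableOn (fun z => Real.exp z - 1) (Ioi 0) ν := by
    refine ⟨by fun_prop, ?_⟩
    rw [hasFiniteIntegral_iff_ofReal hnn]
    exact hJtop.lt_top
  refine ⟨hint, ?_⟩
  rw [integral_eq_lintegral_of_nonneg_ae hnn (by fun_prop), ← hJ]
  clear_value J
  lift J to ℝ≥0 using hJtop
  have e : (((J : ℝ≥0∞)) : EReal) = ((J : ℝ) : EReal) := rfl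
  rw [e, ← EReal.coe_sub] at hd
  have : 0 < r - δ - (J : ℝ) := by exact_mod_cast hd
  simp only [ENNReal.coe_toReal]
  linarith

section CriticalPrice

variable {Ω : Type*} [MeasurableSpace Ω] {P : Measure Ω}
  {X : ℝ≥0 → Ω → ℝ} {b σ : ℝ} {ν : Measure ℝ} {r δ K T : ℝ}

lemma euroPut_eq (hX : ∀ t, Measurable (X t)) (τ s : ℝ) :
    euroPut X P r δ K T (T - τ) s = Real.exp (-r * τ) *
      ∫ x, putPayoff K (s * Real.exp ((r - δ) * τ)) x ∂(P.map (X τ.toNNReal)) := by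
  unfold euroPut
  rw [integral_const_mul, sub_sub_cancel, integral_map (hX _).aemeasurable
    (continuous_putPayoff _ _).aestronglyMeasurable]
  simp only [putPayoff, Real.exp_add, mul_assoc]

/-- By convexity in the price, exercising stays optimal below a price where it is. -/
lemma euroPut_le_of_le [IsProbabilityMeasure P] (hX : ∀ t, Measurable (X t)) (hr : 0 ≤ r)
    (hK : 0 ≤ K) {τ s s₀ : ℝ}
    (hτ : 0 ≤ τ) (hs₀ : 0 < s₀) (hs : 0 ≤ s) (hss₀ : s ≤ s₀)
    (h : euroPut X P r δ K T (T - τ) s₀ ≤ K - s₀) :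
    euroPut X P r δ K T (T - τ) s ≤ K - s := by
  rw [euroPut_eq hX] at h ⊢
  have : IsProbabilityMeasure (P.map (X τ.toNNReal)) :=
    Measure.isProbabilityMeasure_map (hX _).aemeasurable
  set μ := P.map (X τ.toNNReal)
  set l := s / s₀ with hl
  have hl0 : 0 ≤ l := by positivity
  have hl1 : l ≤ 1 := (div_le_one hs₀).2 hss₀
  have hsl : s = l * s₀ := by rw [hl]; field_simp
  set E := Real.exp ((r - δ) * τ)
  have hE : 0 < E := Real.exp_pos _
  have hr1 : Real.exp (-r * τ) ≤ 1 := Real.exp_le_one_iff.2 (by nlinarith)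
  have hi := integrable_putPayoff hK (mul_nonneg hs₀.le hE.le) μ
  have key : ∫ x, putPayoff K (s * E) x ∂μ
      ≤ l * ∫ x, putPayoff K (s₀ * E) x ∂μ + (1 - l) * K := by
    calc _ ≤ ∫ x, (l * putPayoff K (s₀ * E) x + (1 - l) * K) ∂μ := by
          refine integral_mono (integrable_putPayoff hK (mul_nonneg hs hE.le) μ)
            ((hi.const_mul _).add (integrable_const _)) fun x => ?_
          have h1 := mul_le_mul_of_nonneg_left
            (le_max_left (K - s₀ * E * Real.exp x) 0) hl0
          have h2 := mul_nonneg hl0 (putPayoff_nonneg K (s₀ * E) x)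
          have h3 := mul_nonneg (sub_nonneg.2 hl1) hK
          refine max_le ?_ (by simpa using add_nonneg h2 h3)
          simp only [putPayoff]
          rw [hsl]
          linarith
      _ = _ := by
          rw [integral_add (hi.const_mul _) (integrable_const _), integral_const_mul]
          simp
  have hexp := Real.exp_pos (-r * τ)
  calc _ ≤ Real.exp (-r * τ) * (l * ∫ x, putPayoff K (s₀ * E) x ∂μ + (1 - l) * K) :=
        mul_le_mul_of_nonneg_left key hexp.le
    _ = l * (Real.exp (-r * τ) * ∫ x, putPayoff K (s₀ * E) x ∂μ)
        + Real.exp (-r * τ) * ((1 - l) * K) := by ring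
    _ ≤ l * (K - s₀) + 1 * ((1 - l) * K) := by
        refine add_le_add (mul_le_mul_of_nonneg_left h hl0)
          (mul_le_mul_of_nonneg_right hr1 (mul_nonneg (sub_nonneg.2 hl1) hK))
    _ = K - s := by rw [hsl]; ring

lemma IsLevyProcessWithTriplet.charFun_map {v : ℝ} (hX : IsLevyProcessWithTriplet X P b v ν)
    {τ : ℝ} (hτ : 0 ≤ τ) (u : ℝ) :
    charFun (P.map (X τ.toNNReal)) u = Complex.exp (τ * levyExponent b v ν u) := by
  rw [hX.charFun_eq, Real.coe_toNNReal _ hτ]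

/-- Above the critical level, the put is worth no more than its intrinsic value. -/
lemma eventually_euroPut_le [IsProbabilityMeasure P] (hX : IsLevyProcessWithTriplet X P b (σ ^ 2) ν)
    (hmart : MartingaleCondition b (σ ^ 2) ν) (hr : 0 ≤ r) (hK : 0 < K)
    (hσ : 0 < σ) (hd : 0 < dConst r δ ν) {a : ℝ} (ha : σ < a) :
    ∀ᶠ τ : ℝ in 𝓝[>] 0,
      euroPut X P r δ K T (T - τ) (K * Real.exp (-(a * √(-(τ * Real.log τ)))))
        ≤ K - K * Real.exp (-(a * √(-(τ * Real.log τ)))) := by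
  obtain ⟨hI, hlt⟩ := integrableOn_and_lt_of_dConst_pos hd
  set I := ∫ z in Ioi 0, (Real.exp z - 1) ∂ν
  have ha0 : 0 < a := hσ.trans ha
  have hsq : σ ^ 2 < a ^ 2 := pow_lt_pow_left₀ ha hσ.le two_ne_zero
  -- The inflated variance σ² + 2η is the midpoint of σ² and a², hence still below a².
  set η := (a ^ 2 - σ ^ 2) / 4 with hη
  have hη0 : 0 < η := by rw [hη]; linarith
  obtain ⟨M, -, hM⟩ := hX.isLevyMeasure.exists_exponent_bound hη0
  -- The extra r - δ in C accounts for the forward shift (r - δ)τ of the log-price inside the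
  -- exponential moment.
  filter_upwards [self_mem_nhdsWithin, eventually_chernoff_le (a := a) (v := σ ^ 2 + 2 * η)
    (d := r - δ - I) (C := M + (r - δ)) ha0 (by positivity) (by rw [hη]; linarith)
    (by linarith)] with τ h0 ⟨θ, hθ, hch⟩
  have hτ : 0 < τ := h0
  rw [euroPut_eq hX.isLevyProcess.measurable]
  have : IsProbabilityMeasure (P.map (X τ.toNNReal)) :=
    Measure.isProbabilityMeasure_map (hX.isLevyProcess.measurable _).aemeasurable
  set y := √(-(τ * Real.log τ))
  have hy : 0 ≤ a * y := mul_nonneg ha0.le (Real.sqrt_nonneg _)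
  have hput := put_le_of_exponent_bound hX.isLevyMeasure hI (sq_nonneg σ) hτ.le hmart
    (P.map (X τ.toNNReal)) (hX.charFun_map hτ.le) (K := K) (a := -(a * y) + (r - δ) * τ)
    (θ := θ) (B := η * θ ^ 2 + M * θ) hK.le hθ (fun S hS hSm => hM S hS hSm θ hθ)
  rw [mul_assoc, ← Real.exp_add]
  have e1 : θ * (-(a * y) + (r - δ) * τ) + τ * (σ ^ 2 / 2 * θ ^ 2 + (η * θ ^ 2 + M * θ))
      = -θ * (a * y) + τ * ((σ ^ 2 + 2 * η) / 2 * θ ^ 2 + (M + (r - δ)) * θ) := by ring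
  have e2 : -(a * y) + (r - δ) * τ - τ * I = -(a * y) + (r - δ - I) * τ := by ring
  rw [e1, e2, Real.exp_add (-(a * y)) ((r - δ - I) * τ)] at hput
  have hle : ∫ x, putPayoff K (K * Real.exp (-(a * y) + (r - δ) * τ)) x ∂(P.map (X τ.toNNReal))
      ≤ K - K * Real.exp (-(a * y)) := by
    have h1 := mul_le_mul_of_nonneg_left hch hK.le
    have h2 := mul_le_mul_of_nonneg_left (Real.add_one_le_exp ((r - δ - I) * τ))
      (mul_nonneg hK.le (Real.exp_pos (-(a * y))).le)
    linarith
  have hnn : 0 ≤ ∫ x, putPayoff K (K * Real.exp (-(a * y) + (r - δ) * τ)) x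
      ∂(P.map (X τ.toNNReal)) := integral_nonneg fun x => putPayoff_nonneg _ _ _
  -- Since r ≥ 0, discounting only lowers the price.
  have hr1 : Real.exp (-r * τ) ≤ 1 := Real.exp_le_one_iff.2 (by nlinarith)
  exact (mul_le_of_le_one_left hnn hr1).trans hle

lemma exp_le_one_add_two_mul {x : ℝ} (h0 : 0 ≤ x) (h1 : x ≤ 1) : Real.exp x ≤ 1 + 2 * x := by
  have := (abs_le.1 (Real.abs_exp_sub_one_sub_id_le (abs_le.2 ⟨by linarith, h1⟩))).2
  nlinarith

/-- Below the critical level, the put is worth more than its intrinsic value. -/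
lemma eventually_lt_euroPut [IsProbabilityMeasure P] (hX : IsLevyProcessWithTriplet X P b (σ ^ 2) ν)
    (hmart : MartingaleCondition b (σ ^ 2) ν) (hr : 0 ≤ r) (hK : 0 < K)
    (hd : 0 < dConst r δ ν) {a : ℝ} (ha0 : 0 < a) (ha : a < σ) :
    ∀ᶠ τ : ℝ in 𝓝[>] 0, K - K * Real.exp (-(a * √(-(τ * Real.log τ))))
      < euroPut X P r δ K T (T - τ) (K * Real.exp (-(a * √(-(τ * Real.log τ))))) := by
  obtain ⟨hI, hlt⟩ := integrableOn_and_lt_of_dConst_pos hd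
  have hI0 : 0 ≤ ∫ z in Ioi 0, (Real.exp z - 1) ∂ν :=
    setIntegral_nonneg measurableSet_Ioi fun x hx => by
      linarith [Real.one_le_exp (le_of_lt (mem_Ioi.1 hx))]
  have hrδ : 0 < r - δ := by linarith
  have hσ : 0 < σ := ha0.trans ha
  -- Three margins εy are spent: two on the interval reaching to q + 2h with h = εy, one on the mean
  -- correction σ²τ/2. Then a + 3ε is the midpoint of a and σ.
  set ε := (σ - a) / 6 with hε
  have hε0 : 0 < ε := by rw [hε]; linarith
  have hlt' : a + 3 * ε < σ := by rw [hε]; linarith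
  -- C collects the carry costs: e^{rτ} and e^{(r-δ)τ} each exceed 1 by at most twice their
  -- exponent.
  filter_upwards [self_mem_nhdsWithin,
    eventually_lt_gaussian (a' := a + 3 * ε) (v := σ ^ 2) (ε := ε) (C := 2 * r + 2 * (r - δ))
      (by positivity) (pow_lt_pow_left₀ hlt' (by positivity) two_ne_zero) hε0,
    eventually_mul_le_mul_sqrt ha0 hrδ.le,
    eventually_mul_le_mul_sqrt hε0 (C := σ ^ 2 / 2) (by positivity),
    eventually_mul_le one_pos r, eventually_mul_le one_pos (r - δ)] with τ h0 h1 h2 h3 h4 h5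
  have hτ : 0 < τ := h0
  rw [euroPut_eq hX.isLevyProcess.measurable]
  have : IsProbabilityMeasure (P.map (X τ.toNNReal)) :=
    Measure.isProbabilityMeasure_map (hX.isLevyProcess.measurable _).aemeasurable
  set y := √(-(τ * Real.log τ))
  have hy : 0 ≤ y := Real.sqrt_nonneg _
  set q := a * y - (r - δ) * τ with hq
  have hq0 : 0 ≤ q := by rw [hq]; linarith
  have hput := gaussian_put_le hX.isLevyMeasure hI (sq_nonneg σ) hτ.le hmart
    (P.map (X τ.toNNReal)) (hX.charFun_map hτ.le) hK.le
    (mul_nonneg hK.le (Real.exp_pos (-q)).le)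
  have hg := gaussian_put_ge (h := ε * y) hK.le (pow_pos hσ 2) hτ hq0 (by positivity)
  have hmono : Real.exp (-((a + 3 * ε) * y) ^ 2 / (2 * (σ ^ 2 * τ)))
      ≤ Real.exp (-(q + 2 * (ε * y) + σ ^ 2 * τ / 2) ^ 2 / (2 * (σ ^ 2 * τ))) := by
    rw [Real.exp_le_exp]
    refine div_le_div_of_nonneg_right (neg_le_neg ?_) (by positivity)
    refine pow_le_pow_left₀ (by positivity) ?_ 2
    have := mul_pos hrδ hτ
    rw [hq]
    linarith
  have hG : (2 * r + 2 * (r - δ)) * τ < (ε * y) ^ 2 * ((√(2 * Real.pi * (σ ^ 2 * τ)))⁻¹ *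
        Real.exp (-(q + 2 * (ε * y) + σ ^ 2 * τ / 2) ^ 2 / (2 * (σ ^ 2 * τ)))) := by
    refine h1.trans_le ?_
    gcongr
  have hmain := hg.trans hput
  set Ex := (ε * y) ^ 2 * ((√(2 * Real.pi * (σ ^ 2 * τ)))⁻¹ *
        Real.exp (-(q + 2 * (ε * y) + σ ^ 2 * τ / 2) ^ 2 / (2 * (σ ^ 2 * τ))))
  have eq : -q = -(a * y) + (r - δ) * τ := by rw [hq]; ring
  rw [eq, Real.exp_add] at hmain
  rw [← mul_assoc] at hmain
  set V := ∫ x, putPayoff K (K * Real.exp (-(a * y)) * Real.exp ((r - δ) * τ)) x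
    ∂(P.map (X τ.toNNReal))
  set w := Real.exp (-(a * y))
  have hw0 : 0 < w := Real.exp_pos _
  have hw1 : w ≤ 1 := Real.exp_le_one_iff.2 (by nlinarith)
  have hx1 := exp_le_one_add_two_mul (x := r * τ) (by positivity) h4
  have hx2 := exp_le_one_add_two_mul (x := (r - δ) * τ) (by positivity) h5
  have b1 : w * Real.exp ((r - δ) * τ) ≤ w + 2 * ((r - δ) * τ) := by
    have hpos := mul_pos hrδ hτ
    nlinarith [mul_le_mul_of_nonneg_left hx2 hw0.le]
  have b2 : Real.exp (r * τ) * (1 - w) ≤ 1 - w + 2 * (r * τ) := by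
    have hpos := mul_nonneg hr hτ.le
    nlinarith [mul_le_mul_of_nonneg_right hx1 (sub_nonneg.2 hw1)]
  have b3 : Real.exp (r * τ) * (K - K * w) < V := by
    have c1 : Real.exp (r * τ) * (1 - w) < 1 - w * Real.exp ((r - δ) * τ) + Ex := by linarith
    have c2 := mul_lt_mul_of_pos_left c1 hK
    calc Real.exp (r * τ) * (K - K * w) = K * (Real.exp (r * τ) * (1 - w)) := by ring
      _ < K * (1 - w * Real.exp ((r - δ) * τ) + Ex) := c2
      _ = K - K * w * Real.exp ((r - δ) * τ) + K * Ex := by ring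
      _ ≤ V := hmain
  have b4 := mul_lt_mul_of_pos_left b3 (Real.exp_pos (-r * τ))
  have b5 : Real.exp (-r * τ) * (Real.exp (r * τ) * (K - K * w)) = K - K * w := by
    rw [← mul_assoc, ← Real.exp_add]; simp
  rwa [b5] at b4

end CriticalPrice

end ExpLevy

end

/-! ### The limit -/

open ExpLevy in
theorem mainTheorem2 {Ω : Type*} [MeasurableSpace Ω] (P : Measure Ω) [IsProbabilityMeasure P]
    (X : ℝ≥0 → Ω → ℝ) (b σ : ℝ) (ν : Measure ℝ) (r δ K T : ℝ)
    (hX : ExpLevy.IsLevyProcessWithTriplet X P b (σ ^ 2) ν)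
    (hmart : ExpLevy.MartingaleCondition b (σ ^ 2) ν)
    (hr : 0 ≤ r) (hδ : 0 ≤ δ) (hK : 0 < K) (hT : 0 < T)
    (hσ : 0 < σ) (hd : 0 < ExpLevy.dConst r δ ν) :
    Tendsto (fun τ : ℝ => ExpLevy.zeta X P r δ K T τ / Real.sqrt (-(τ * Real.log τ)))
      (𝓝[>] 0) (𝓝 σ) := by
  have hX' := hX.isLevyProcess.measurable
  have hmem : ∀ a, 0 < a → a < σ → ∀ᶠ τ : ℝ in 𝓝[>] 0,
      K * Real.exp (-(a * √(-(τ * Real.log τ)))) ∈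
        {s : ℝ | 0 ≤ s ∧ max (K - s) 0 < euroPut X P r δ K T (T - τ) s} := by
    intro a ha0 ha
    filter_upwards [eventually_lt_euroPut (T := T) hX hmart hr hK hd ha0 ha] with τ h
    refine ⟨by positivity, ?_⟩
    rwa [max_eq_left]
    have : Real.exp (-(a * √(-(τ * Real.log τ)))) ≤ 1 :=
      Real.exp_le_one_iff.2 (by simp only [Left.neg_nonpos_iff]; positivity)
    nlinarith
  have hlow : ∀ a, σ < a → ∀ᶠ τ : ℝ in 𝓝[>] 0,
      K * Real.exp (-(a * √(-(τ * Real.log τ)))) ≤ euroCritPrice X P r δ K T (T - τ) := by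
    intro a ha
    -- The choice σ/2 only serves to make the set nonempty; the infimum of the empty set would be 0.
    filter_upwards [eventually_euroPut_le (T := T) hX hmart hr hK hσ hd ha,
      hmem (σ / 2) (by linarith) (by linarith), self_mem_nhdsWithin] with τ h hne hτ
    refine le_csInf ⟨_, hne⟩ fun s hs => ?_
    by_contra! hlt
    have := euroPut_le_of_le hX' hr hK.le (le_of_lt (mem_Ioi.1 hτ)) (by positivity) hs.1 hlt.le h
    exact absurd (hs.2.trans_le this) (not_lt.2 (le_max_left _ _))
  have hupp : ∀ a, 0 < a → a < σ → ∀ᶠ τ : ℝ in 𝓝[>] 0,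
      euroCritPrice X P r δ K T (T - τ) ≤ K * Real.exp (-(a * √(-(τ * Real.log τ)))) := by
    intro a ha0 ha
    filter_upwards [hmem a ha0 ha] with τ h
    exact csInf_le ⟨0, fun s hs => hs.1⟩ h
  have hypos : ∀ᶠ τ : ℝ in 𝓝[>] 0, 0 < √(-(τ * Real.log τ)) := by
    filter_upwards [eventually_log_le (-1), self_mem_nhdsWithin] with τ h1 h2
    exact lt_of_lt_of_le (Real.rpow_pos_of_pos h2 _)
      (rpow_half_le_sqrt_neg_mul_log (le_of_lt (mem_Ioi.1 h2)) h1)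
  refine tendsto_order.2 ⟨fun a ha => ?_, fun a ha => ?_⟩
  -- The maximum with 0 covers negative a. The level σ + 1 used below only ensures that the critical
  -- price is positive.
  · obtain ⟨c, hc1, hc2⟩ := exists_between (max_lt ha hσ)
    have hc0 : 0 < c := (le_max_right _ _).trans_lt hc1
    filter_upwards [hupp c hc0 hc2, hlow (σ + 1) (by linarith), hypos] with τ h1 h2 hy
    have hb : 0 < euroCritPrice X P r δ K T (T - τ) := lt_of_lt_of_le (by positivity) h2
    rw [lt_div_iff₀ hy, zeta]
    set y := √(-(τ * Real.log τ))
    have h3 : Real.exp (c * y) ≤ K / euroCritPrice X P r δ K T (T - τ) := by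
      rw [le_div_iff₀ hb]
      calc _ ≤ Real.exp (c * y) * (K * Real.exp (-(c * y))) := by gcongr
        _ = K := by rw [Real.exp_neg]; field_simp
    have h4 := Real.add_one_le_exp (c * y)
    have h5 : a * y < c * y := mul_lt_mul_of_pos_right ((le_max_left _ _).trans_lt hc1) hy
    linarith
  · obtain ⟨c, hc1, hc2⟩ := exists_between ha
    have hc0 : 0 < c := hσ.trans hc1
    -- For cy ≤ 1 one has e^{cy} - 1 ≤ cy + (cy)², and c²y < a - c absorbs the quadratic term into
    -- ay.
    have t1 := (tendsto_sqrt_neg_mul_log.const_mul c).eventually_le_const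
      (show c * 0 < 1 by simp)
    have t2 := (tendsto_sqrt_neg_mul_log.const_mul (c ^ 2)).eventually_lt_const
      (show c ^ 2 * 0 < a - c by linarith)
    filter_upwards [hlow c hc1, hypos, t1, t2] with τ h2 hy t1 t2
    have hb : 0 < euroCritPrice X P r δ K T (T - τ) := lt_of_lt_of_le (by positivity) h2
    rw [div_lt_iff₀ hy, zeta]
    set y := √(-(τ * Real.log τ))
    have h3 : K / euroCritPrice X P r δ K T (T - τ) ≤ Real.exp (c * y) := by
      rw [div_le_iff₀ hb]
      calc K = Real.exp (c * y) * (K * Real.exp (-(c * y))) := by rw [Real.exp_neg]; field_simp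
        _ ≤ _ := by gcongr
    have hcy : 0 ≤ c * y := by positivity
    have h4 := (abs_le.1 (Real.abs_exp_sub_one_sub_id_le (abs_le.2 ⟨by linarith, t1⟩))).2
    nlinarith
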